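/- **Conventions.** A grid diagram $G$ of grid number $k$ is a $k\times k$ square grid with $k$ markings $O$ and $k$ markings $X$ such that every row and every column contains exactly one $O$ and one $X$, and no square contains both. Its braid $w(G)$ is the word read from the bottom up in the following diagram: in each row draw a horizontal segment from the $O$ to the $X$; in each column draw an upward vertical segment from the $X$ to the $O$ (if the $X$ is above the $O$, it leaves through the top of the grid and re-enters at the bottom); horizontal segments pass over vertical ones. It has one strand for every column whose $X$ is above its $O$. For $w$ in Artin's braid group $B_n$, with standard (positive) generators $\sigma_1,\dots,\sigma_{n-1}$, let $T_w$ be the corresponding transverse braid in $(\mathbb{R}^3,\xi_{rot})$; $G$ is a grid diagram for $T_w$ if $w(G)$ has $n$ strands and $w(G)=w$ in $B_n$. Now view $G$ on the torus, with $k$ horizontal and $k$ vertical circles. Let $\mathbf S(G)$ be the set of bijections between vertical and horizontal circles, regarded as $k$-tuples of intersection points. Let $\widetilde{CFL}(G)$ be the $\mathbb{F}_2$-vector space with basis $\mathbf S(G)$, and let $\widetilde\partial \mathbf x=\sum_{\mathbf y} \#R(\mathbf x,\mathbf y)\,\mathbf y$, where $R(\mathbf x,\mathbf y)$ is the set of embedded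 rectangles with edges on the circles, whose lower left and upper right corners are points of $\mathbf x$ and whose other two corners are points of $\mathbf y$, where $\mathbf x$ and $\mathbf y$ agree in all other points, and which contain no marking and, in their interior, no point of $\mathbf x$. Let $\widetilde{HFL}(G)$ be the homology of $(\widetilde{CFL}(G),\widetilde\partial)$, and let $\widetilde\theta(G)\in\widetilde{HFL}(G)$ be the class of the cycle $\mathbf z^+(G)$ consisting of the upper right corners of the squares marked $X$. If $G$ is a grid diagram for $T_w$, these are $\widetilde{HFL}(m(T_w))$ and $\widetilde\theta(T_w)$, computed from $G$. Let $G_\beta$ and $G_\gamma$ be two toroidal grid diagrams with the same markings and the same circles, except that one horizontal circle $\beta$ of $G_\beta$ is replaced by a circle $\gamma$ in $G_\gamma$, where $\beta$ and $\gamma$ meet transversely in two points, off the vertical circles, and bound two bigons, each containing one $X$ and no $O$. (So $G_\gamma$ is obtained from $G_\beta$ by exchanging the $X$'s of the two rows adjacent to $\beta$; $\beta$ lies above the $X$ of the lower of these rows.) Let $a\in\beta\cap\gamma$ be the point at which, moving to the right, $\beta$ passes from above $\gamma$ to below $\gamma$. For $\mathbf x\in\mathbf S(G_\beta)$ and $\mathbf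 y\in\mathbf S(G_\gamma)$ that agree (away from $\beta$ and $\gamma$) in $k-2$ points, let $P(\mathbf x,\mathbf y)$ be the set of embedded pentagons that contain no marking and, in their interior, no point of $\mathbf x$, and whose boundary, in its induced orientation, runs from the point of $\mathbf x$ on $\beta$ along $\beta$ to $a$, along $\gamma$ to the point of $\mathbf y$ on $\gamma$, along a vertical circle to a point of $\mathbf x$, along a horizontal circle to a point of $\mathbf y$, and along a vertical circle back to the start; otherwise let $P(\mathbf x,\mathbf y)=\emptyset$. Let $\widetilde\phi:\widetilde{CFL}(G_\beta)\to\widetilde{CFL}(G_\gamma)$ be the linear map with $\widetilde\phi(\mathbf x)=\sum_{\mathbf y}\#P(\mathbf x,\mathbf y)\,\mathbf y$. **Theorem.** Let $w\in B_n$ and let $\sigma_i$, $1\le i\le n-1$, be a standard generator. There are grid diagrams $G_\beta$ for $T_{w\sigma_i}$ and $G_\gamma$ for $T_w$, of the same grid number, that differ in one horizontal curve in the way just described, such that $\widetilde\phi$ is a chain map and the map it induces on homology, $$\widetilde\Phi:\widetilde{HFL}(m(T_{w\sigma_i}))=\widetilde{HFL}(G_\beta)\longrightarrow \widetilde{HFL}(G_\gamma)=\widetilde{HFL}(m(T_w)),$$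 satisfies $\widetilde\Phi(\widetilde\theta(T_{w\sigma_i}))=\widetilde\theta(T_w)$. -/

import Mathlib

/-! ### Braid groups -/

/-- The Artin relations among the generators `σ_1, …, σ_{n-1}` (indexed by `Fin (n - 1)`). -/
def braidRels (n : ℕ) : Set (FreeGroup (Fin (n - 1))) :=
  {g | ∃ i j : Fin (n - 1), i.val + 1 = j.val ∧
      g = (FreeGroup.of i * FreeGroup.of j * FreeGroup.of i) *
        (FreeGroup.of j * FreeGroup.of i * FreeGroup.of j)⁻¹} ∪
  {g | ∃ i j : Fin (n - 1), i.val + 1 < j.val ∧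
      g = (FreeGroup.of i * FreeGroup.of j) * (FreeGroup.of j * FreeGroup.of i)⁻¹}

/-- Artin's braid group `B_n` on `n` strands. -/
abbrev BraidGroup (n : ℕ) : Type := PresentedGroup (braidRels n)

/-- The standard generators: `BraidGroup.σ i` is the positive crossing of the strands in
positions `i` and `i + 1`, counted from the left and from `0`. -/
def BraidGroup.σ {n : ℕ} (i : Fin (n - 1)) : BraidGroup n := PresentedGroup.of i

/-- The braid spelled by a word; `(i, true)` stands for `σ i` and `(i, false)` for its inverse. -/
def BraidGroup.ofWord {n : ℕ} (v : List (Fin (n - 1) × Bool)) : BraidGroup n :=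
  PresentedGroup.mk (braidRels n) (FreeGroup.mk v)

/-! ### Toroidal grids

Columns are numbered from left to right and rows from bottom to top by `Fin k`. The vertical
circle `c` is the left edge of column `c`, and the horizontal circle `r` is the bottom edge of
row `r`. Arithmetic in `Fin k` is modulo `k`. -/

/-- The columns (or rows) met when moving right (or up) from circle `s` to circle `t`. -/
def cyc {k : ℕ} (s t : Fin k) : Finset (Fin k) :=
  Finset.univ.filter fun c => (c - s).val < (t - s).val

/-- The circles strictly between circle `s` and circle `t`, moving right (or up) from `s`. -/
def cycOpen {k : ℕ} (s t : Fin k) : Finset (Fin k) := (cyc s t).erase s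

/-- A grid diagram of grid number `k`: `O c` and `X c` are the rows of the markings `O` and `X`
in column `c`. -/
structure GridDiagram (k : ℕ) where
  O : Equiv.Perm (Fin k)
  X : Equiv.Perm (Fin k)
  disjoint : ∀ c, O c ≠ X c

namespace GridDiagram

variable {k : ℕ}

/-! ### The braid of a grid diagram

In every row a horizontal segment runs from the `O` to the `X`. In every column a vertical
segment runs upwards from the `X` to the `O`; where the `X` is above the `O` it leaves through
the top of the square and comes back from the bottom. Horizontal segments pass over. -/

/-- The number of strands: one for every column whose `X` is above its `O`. -/
def strands (G : GridDiagram k) : ℕ := (Finset.univ.filter fun c => G.O c < G.X c).card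

/-- The columns whose vertical segment arrives from below at the level of row `r`. -/
def activeCols (G : GridDiagram k) (r : Fin k) : Finset (Fin k) :=
  Finset.univ.filter fun c =>
    (G.X c < r ∧ r ≤ G.O c) ∨ (G.O c < G.X c ∧ (r ≤ G.O c ∨ G.X c < r))

/-- The letters contributed by row `r`. The strand at position `p` moves to position `q`, over
the strands between. The crossings are positive if it moves to the right and negative if it moves
to the left. -/
def rowWord (G : GridDiagram k) (r : Fin k) : List (ℕ × Bool) :=
  let p := ((G.activeCols r).filter (· < G.O.symm r)).card
  let q := (((G.activeCols r).erase (G.O.symm r)).filter (· < G.X.symm r)).card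
  if p ≤ q then (List.range' p (q - p)).map fun j => (j, true)
  else (List.range' q (p - q)).reverse.map fun j => (j, false)

/-- The braid word `w(G)` of a grid diagram, read from the bottom up. -/
def braidWord (G : GridDiagram k) : List (ℕ × Bool) := (List.ofFn G.rowWord).flatten

/-- The braid of `G` has `n` strands and equals `w` in `B_n`, so that `G` is a grid diagram for
the transverse braid `T_w`. -/
def Represents (G : GridDiagram k) {n : ℕ} (w : BraidGroup n) : Prop :=
  G.strands = n ∧ ∃ v : List (Fin (n - 1) × Bool),
    v.map (fun l => (l.1.val, l.2)) = G.braidWord ∧ BraidGroup.ofWord v = w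

/-! ### The chain complex and its homology

A generator is a permutation `x` of `Fin k`: it has the point on the vertical circle `c` and the
horizontal circle `x c`, for every `c`. -/

/-- The rectangles from `x` to `y` whose interior contains no point of `x` and which contain no
marking. The pair `(s, t)` stands for the rectangle between the vertical circles `s` and `t` with
lower left corner `(s, x s)` and upper right corner `(t, x t)`, both in `x`; its other corners
are in `y`. So its horizontal edges run, in the boundary orientation, from `x` to `y`. -/
def rect (G : GridDiagram k) (x y : Equiv.Perm (Fin k)) : Finset (Fin k × Fin k) :=
  Finset.univ.filter fun p => p.1 ≠ p.2 ∧ y = x * Equiv.swap p.1 p.2 ∧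
    (∀ c ∈ cycOpen p.1 p.2, x c ∉ cycOpen (x p.1) (x p.2)) ∧
    (∀ c ∈ cyc p.1 p.2, G.X c ∉ cyc (x p.1) (x p.2)) ∧
    (∀ c ∈ cyc p.1 p.2, G.O c ∉ cyc (x p.1) (x p.2))

/-- The vector space over the field of two elements generated by the generators of a grid of
grid number `k`. -/
abbrev Chain (k : ℕ) : Type := Equiv.Perm (Fin k) →₀ ZMod 2

/-- The differential of `CFL-tilde`. -/
noncomputable def bd (G : GridDiagram k) : Chain k →ₗ[ZMod 2] Chain k :=
  Finsupp.linearCombination (ZMod 2) fun x =>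
    ∑ y, Finsupp.single y ((G.rect x y).card : ZMod 2)

/-- The cycles. -/
noncomputable abbrev cycles (G : GridDiagram k) : Submodule (ZMod 2) (Chain k) :=
  LinearMap.ker G.bd

/-- The boundaries, as a subspace of the space of cycles (every boundary is a cycle). -/
noncomputable abbrev boundaries (G : GridDiagram k) : Submodule (ZMod 2) G.cycles :=
  (LinearMap.range G.bd).submoduleOf G.cycles

/-- `HFL-tilde`: cycles modulo boundaries. -/
abbrev HFLTilde (G : GridDiagram k) : Type := G.cycles ⧸ G.boundaries

/-- The map on homology induced by a chain map `f`. -/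
noncomputable def homologyMap {G G' : GridDiagram k} (f : Chain k →ₗ[ZMod 2] Chain k)
    (hf : f ∘ₗ G.bd = G'.bd ∘ₗ f) : G.HFLTilde →ₗ[ZMod 2] G'.HFLTilde :=
  Submodule.mapQ G.boundaries G'.boundaries
    (f.restrict (p := G.cycles) (q := G'.cycles) (fun z hz => by
      have h := LinearMap.congr_fun hf z
      simp only [LinearMap.comp_apply] at h
      rw [LinearMap.mem_ker] at hz ⊢
      rw [← h, hz, map_zero]))
    (by
      rintro ⟨z, hz⟩ ⟨y, hy⟩
      refine ⟨f y, ?_⟩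
      have h := LinearMap.congr_fun hf y
      simp only [LinearMap.comp_apply] at h
      rw [← h, hy]
      rfl)

/-- The generator `z⁺(G)`: the upper right corners of the squares marked `X`. -/
def zPlus [NeZero k] (G : GridDiagram k) : Equiv.Perm (Fin k) :=
  (Equiv.subRight 1).trans (G.X.trans (Equiv.addRight 1))

theorem sub_one_mem_cyc [NeZero k] {s t : Fin k} (h : s ≠ t) : t - 1 ∈ cyc s t := by
  obtain _ | k := k
  · exact s.elim0
  have h0 : t - s ≠ 0 := sub_ne_zero.mpr (Ne.symm h)
  have e : t - 1 - s = (t - s) - 1 := by abel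
  simp only [cyc, Finset.mem_filter, Finset.mem_univ, true_and, e]
  refine Fin.lt_def.mp (Fin.sub_one_lt_iff.mpr ?_)
  exact (Fin.pos_iff_ne_zero' _).mpr h0

theorem rect_zPlus [NeZero k] (G : GridDiagram k) (y : Equiv.Perm (Fin k)) :
    G.rect G.zPlus y = ∅ := by
  rw [rect, Finset.filter_eq_empty_iff]
  rintro ⟨s, t⟩ - ⟨hst, -, -, hX, -⟩
  refine hX (t - 1) (sub_one_mem_cyc hst) ?_
  have e : G.X (t - 1) = G.zPlus t - 1 := by simp [zPlus]
  simp only [e]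
  exact sub_one_mem_cyc fun h => hst (G.zPlus.injective h)

theorem zPlus_mem_cycles [NeZero k] (G : GridDiagram k) :
    Finsupp.single G.zPlus 1 ∈ G.cycles := by
  simp [bd, rect_zPlus]

/-- The invariant `θ-tilde`, the class of `z⁺(G)`. -/
noncomputable def theta [NeZero k] (G : GridDiagram k) : G.HFLTilde :=
  Submodule.Quotient.mk ⟨Finsupp.single G.zPlus 1, G.zPlus_mem_cycles⟩

end GridDiagram

/-! ### Grid diagrams that differ in one horizontal curve -/

/-- Two grid diagrams on one torus with the same markings, the same vertical circles and the same
horizontal circles, except that `Gβ` uses `β` and `Gγ` uses `γ` as its horizontal circle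
`row + 1`. The curves `β` and `γ` cross in two points, off the vertical circles, and together
bound two bigons. Each bigon contains one `X` and no `O`:
* at the `X` in column `Gβ.X.symm row`, `β` is above `γ`; this `X` is in row `row` for `Gβ` and
  in row `row + 1` for `Gγ`;
* at the `X` in column `Gβ.X.symm (row + 1)`, `γ` is above `β`; this `X` is in row `row + 1` for
  `Gβ` and in row `row` for `Gγ`.

`cross` is the column of the crossing (called `a` below) at which, moving to the right, `β` goes
from being above `γ` to being below it. So, moving to the right, `a` comes after the first `X`
and before the second; if it is in the column of the first (second) `X`, it is to the right
(left) of that `X`. The place of the other crossing does not matter for what follows. -/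
structure CombinedDiagram (k : ℕ) [NeZero k] where
  Gβ : GridDiagram k
  Gγ : GridDiagram k
  row : Fin k
  cross : Fin k
  O_eq : Gγ.O = Gβ.O
  X_eq : Gγ.X = Equiv.swap row (row + 1) * Gβ.X
  cross_mem : (cross - Gβ.X.symm row).val ≤ (Gβ.X.symm (row + 1) - Gβ.X.symm row).val

namespace CombinedDiagram

variable {k : ℕ} [NeZero k]

/-- The region between the vertical circles `l`, `r` and the horizontal circles `b`, `t`, where
one of `b`, `t` is the circle `row + 1` and stands for the path that changes, at `a`, from the
curve of `Gl` (left of `a`) to the curve of `Gr` (right of `a`). It is empty: its interior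
contains no point of `x`, and it contains no marking. To the left (right) of column `cross` the
region consists of squares of `Gl` (`Gr`). In column `cross` it lies above both curves or below
both curves, so there it contains an `X` only if this is so for `Gl` and for `Gr`. -/
def Empty (D : CombinedDiagram k) (x : Equiv.Perm (Fin k)) (Gl Gr : GridDiagram k)
    (l r b t : Fin k) : Prop :=
  (∀ c ∈ cycOpen l r, x c ∉ cycOpen b t) ∧
  (∀ c ∈ cyc l D.cross, Gl.X c ∉ cyc b t) ∧
  (∀ c ∈ cyc (D.cross + 1) r, Gr.X c ∉ cyc b t) ∧
  ¬ (Gl.X D.cross ∈ cyc b t ∧ Gr.X D.cross ∈ cyc b t) ∧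
  (∀ c ∈ cyc l r, D.Gβ.O c ∉ cyc b t)

instance (D : CombinedDiagram k) (x : Equiv.Perm (Fin k)) (Gl Gr : GridDiagram k)
    (l r b t : Fin k) : Decidable (D.Empty x Gl Gr l r b t) := by
  unfold Empty; infer_instance

/-- The empty pentagons from the generator `x` of `Gβ` to the generator `y` of `Gγ` that miss all
markings. The boundary runs from the point of `x` on `β`, on the vertical circle
`u = x.symm (row + 1)`, along `β` to `a`, along `γ` to the point of `y` on the vertical circle
`v`, along this circle to the point `(v, x v)` of `x`, along a horizontal circle to the point
`(u, x v)` of `y`, and along a vertical circle back to the start; the pentagon is on its left.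
Given `u` and `v` there is one such pentagon. If `a` is met when moving right from `u` to `v`,
the pentagon lies above `β` (left of `a`) and `γ` (right of `a`). Otherwise `a` is met when
moving left from `u` to `v`, and the pentagon lies below `γ` (left of `a`) and `β` (right of
`a`). -/
def pent (D : CombinedDiagram k) (x y : Equiv.Perm (Fin k)) : Finset (Fin k) :=
  Finset.univ.filter fun v =>
    v ≠ x.symm (D.row + 1) ∧ y = x * Equiv.swap (x.symm (D.row + 1)) v ∧
    if D.cross ∈ cyc (x.symm (D.row + 1)) v then
      D.Empty x D.Gβ D.Gγ (x.symm (D.row + 1)) v (D.row + 1) (x v)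
    else
      D.Empty x D.Gγ D.Gβ v (x.symm (D.row + 1)) (x v) (D.row + 1)

/-- The map `φ-tilde` from `CFL-tilde` of `Gβ` to `CFL-tilde` of `Gγ` that counts pentagons. -/
noncomputable def phi (D : CombinedDiagram k) :
    GridDiagram.Chain k →ₗ[ZMod 2] GridDiagram.Chain k :=
  Finsupp.linearCombination (ZMod 2) fun x =>
    ∑ y, Finsupp.single y ((D.pent x y).card : ZMod 2)

end CombinedDiagram

/-! Why `φ` is a chain map. Apart from the two `X`s in the bigons, both diagrams have the same
markings (`OuterMarking`). Relative to these, the rectangles of `Gβ`, the rectangles of `Gγ` and the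
pentagons are all clear rectangles on one torus. They differ only in a condition on the columns of
the two remaining `X`s and of the crossing (`mem_rect_β`, `mem_rect_γ`, `mem_pent`), in which the
two `X`s change roles between `β` and `γ`. Hence `φ ∂ + ∂ φ` is a sum over pairs of consecutive
clear rectangles, weighted by the parity of the ways to make one of them a pentagon. Pairs without a
common vertical circle commute. Pairs on three vertical circles either form an L-shape, which can be
cut in two ways of equal weight (`clearPair_iff_of_mem`, `pentagonParity_eq_of_mem` and their primed
versions), or together cover a whole column or row. The latter is impossible, as is an annulus,
because every row and column has an `O`. So all terms cancel modulo two (`phi_comp_bd`).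

Why `θ` goes to `θ`. A rectangle starting at `z⁺` has an `X` in its upper right square. If the
crossing is in the column of the upper `X`, this leaves one candidate for a pentagon: a strip of
height one that ends at this `X`. It is empty as soon as the `O` of its row lies outside, and it
ends at `z⁺(Gγ)` (`pentagon_zPlus_iff`).

Why suitable diagrams exist. A word is realized with one block of rows per letter and one block of
columns per position; the order of the times inside the column blocks gives the signs. Replacing a
letter `σ i` by an empty step exchanges the `X`s of two adjacent rows. The sign of `σ i` puts the
`O` between the upper and the lower `X`, while the strip runs around the torus the other way. -/

/-! ### Cyclic intervals -/

section CyclicIntervals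

variable {k : ℕ} {a b c d s t u v : Fin k}

/-- Reduces cyclic intervals to linear inequalities, so that `omega` settles the lemmas on cyclic
order. -/
theorem mem_cyc :
    c ∈ cyc s t ↔ (s.val ≤ c.val ∧ c.val < t.val) ∨
      (t.val < s.val ∧ (s.val ≤ c.val ∨ c.val < t.val)) := by
  have key : ∀ x : Fin k, (s ≤ x ∧ (x - s).val = x.val - s.val) ∨
      (x < s ∧ (x - s).val = k + x.val - s.val) := fun x => by
    rcases le_or_gt s x with h | h
    · exact Or.inl ⟨h, Fin.coe_sub_iff_le.mpr h⟩
    · exact Or.inr ⟨h, Fin.coe_sub_iff_lt.mpr h⟩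
  simp only [cyc, Finset.mem_filter, Finset.mem_univ, true_and]
  have := key c
  have := key t
  simp only [Fin.le_def, Fin.lt_def] at *
  omega

theorem mem_cycOpen :
    c ∈ cycOpen s t ↔ (s.val < c.val ∧ c.val < t.val) ∨
      (t.val < s.val ∧ (s.val < c.val ∨ c.val < t.val)) := by
  simp only [cycOpen, Finset.mem_erase, mem_cyc, ne_eq, Fin.ext_iff]
  omega

theorem left_mem_cyc (h : s ≠ t) : s ∈ cyc s t := by
  rw [mem_cyc]; rw [Ne, Fin.ext_iff] at h; omega

theorem mem_cyc_iff_notMem_cyc (h : s ≠ t) : c ∈ cyc s t ↔ c ∉ cyc t s := by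
  rw [mem_cyc, mem_cyc]; rw [Ne, Fin.ext_iff] at h; omega

theorem cyc_split (h : b ∈ cycOpen a c) : d ∈ cyc a c ↔ d ∈ cyc a b ∨ d ∈ cyc b c := by
  simp only [mem_cyc, mem_cycOpen] at *; omega

theorem cyc_disjoint (h : b ∈ cycOpen a c) (hd : d ∈ cyc a b) : d ∉ cyc b c := by
  simp only [mem_cyc, mem_cycOpen] at *; omega

theorem cyc_cover (h : c ∈ cycOpen a b) : d ∈ cyc a b ∨ d ∈ cyc b c := by
  simp only [mem_cyc, mem_cycOpen] at *; omega

theorem cycOpen_split (h : b ∈ cycOpen a c) :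
    d ∈ cycOpen a c ↔ d ∈ cycOpen a b ∨ d = b ∨ d ∈ cycOpen b c := by
  simp only [mem_cycOpen, Fin.ext_iff] at *; omega

theorem cycOpen_rotate (h : b ∈ cycOpen a c) : c ∈ cycOpen b a := by
  simp only [mem_cycOpen] at *; omega

theorem cycOpen_rotate_iff : b ∈ cycOpen a c ↔ c ∈ cycOpen b a := by
  simp only [mem_cycOpen] at *; omega

theorem cycOpen_asymm (h : b ∈ cycOpen a c) : c ∉ cycOpen a b := by
  simp only [mem_cycOpen] at *; omega

theorem cycOpen_total (hab : a ≠ b) (hbc : b ≠ c) (hac : a ≠ c) :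
    b ∈ cycOpen a c ∨ c ∈ cycOpen a b := by
  simp only [mem_cycOpen, Fin.ext_iff, ne_eq] at *; omega

theorem left_notMem_cycOpen : s ∉ cycOpen s t := by
  simp only [mem_cycOpen]; omega

theorem right_notMem_cycOpen : t ∉ cycOpen s t := by
  simp only [mem_cycOpen]; omega

theorem right_notMem_cyc : t ∉ cyc s t := by
  simp only [mem_cyc]; omega

theorem cycOpen_ne (h : b ∈ cycOpen a c) : a ≠ b ∧ b ≠ c ∧ a ≠ c := by
  simp only [mem_cycOpen, Fin.ext_iff, ne_eq] at *; omega

theorem right_mem_of_exit (hu : u ∈ cycOpen s t) (hv : v ∉ cycOpen s t) (h : v ≠ t) :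
    t ∈ cycOpen u v := by
  simp only [mem_cycOpen, Fin.ext_iff, ne_eq] at *; omega

theorem left_mem_of_exit (hu : u ∈ cycOpen s t) (hv : v ∉ cycOpen s t) (h : v ≠ s) :
    s ∈ cycOpen v u := by
  simp only [mem_cycOpen, Fin.ext_iff, ne_eq] at *; omega

end CyclicIntervals

/-! ### Pairs of consecutive empty rectangles -/

section ClearRect

open Equiv

variable {k : ℕ} {Mk : Fin k → Fin k → Prop} {x : Perm (Fin k)} {a b c s t s' t' : Fin k}

/-- The rectangle with lower left corner `(s, x s)` and upper right corner `(t, x t)` contains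
no point of `x` in its interior and none of the markings `Mk`. -/
def ClearRect (Mk : Fin k → Fin k → Prop) (x : Perm (Fin k)) (s t : Fin k) : Prop :=
  s ≠ t ∧ (∀ c ∈ cycOpen s t, x c ∉ cycOpen (x s) (x t)) ∧
    ∀ c ∈ cyc s t, ∀ r ∈ cyc (x s) (x t), ¬ Mk c r

/-- A rectangle `(s, t)` from `x` followed by a rectangle `(s', t')`. -/
def ClearPair (Mk : Fin k → Fin k → Prop) (x : Perm (Fin k)) (s t s' t' : Fin k) : Prop :=
  ClearRect Mk x s t ∧ ClearRect Mk (x * swap s t) s' t'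

/-- If a corner of one rectangle lay inside the other, its neighbours, being points of the
intermediate generator, would lie outside. The rectangles would then overlap at opposite corners,
and the first would contain a point of `x`. -/
theorem ClearPair.comm_of_disjoint (h1 : s ≠ s') (h2 : s ≠ t') (h3 : t ≠ s') (h4 : t ≠ t')
    (h : ClearPair Mk x s t s' t') : ClearPair Mk x s' t' s t := by
  obtain ⟨⟨hst, hp, hm⟩, hst', hp', hm'⟩ := h
  have e1 : (x * swap s t) s' = x s' := by simp [swap_apply_of_ne_of_ne h1.symm h3.symm]
  have e2 : (x * swap s t) t' = x t' := by simp [swap_apply_of_ne_of_ne h2.symm h4.symm]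
  have e3 : (x * swap s' t') s = x s := by simp [swap_apply_of_ne_of_ne h1 h2]
  have e4 : (x * swap s' t') t = x t := by simp [swap_apply_of_ne_of_ne h3 h4]
  have ws : (x * swap s t) s = x t := by simp
  have wt : (x * swap s t) t = x s := by simp
  rw [e1, e2] at hp' hm'
  have inj : ∀ {p q : Fin k}, p ≠ q → x p ≠ x q := fun h => x.injective.ne h
  refine ⟨⟨hst', fun p hpm hx => ?_, hm'⟩, hst, fun p hpm hx => ?_, ?_⟩
  · have key := hp' p hpm
    rcases eq_or_ne p s with rfl | hps
    · rw [ws] at key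
      have ht : t ∉ cycOpen s' t' := fun h => hp' t h (by rwa [wt])
      exact hp t' (right_mem_of_exit hpm ht h4) (right_mem_of_exit hx key (inj h4))
    rcases eq_or_ne p t with rfl | hpt
    · rw [wt] at key
      have ht : s ∉ cycOpen s' t' := fun h => hp' s h (by rwa [ws])
      exact hp s' (left_mem_of_exit hpm ht h1) (left_mem_of_exit hx key (inj h1))
    · apply key
      simpa [swap_apply_of_ne_of_ne hps hpt] using hx
  · rw [e3, e4] at hx
    rcases eq_or_ne p s' with rfl | hps
    · have e : (x * swap p t') p = x t' := by simp
      rw [e] at hx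
      have ht : t' ∉ cycOpen s t := fun h => hp t' h hx
      have h5 := hp p hpm
      refine hp' t (right_mem_of_exit hpm ht h4.symm) ?_
      rw [wt]
      exact left_mem_of_exit hx h5 (inj h1.symm)
    rcases eq_or_ne p t' with rfl | hpt
    · have e : (x * swap s' p) p = x s' := by simp
      rw [e] at hx
      have ht : s' ∉ cycOpen s t := fun h => hp s' h hx
      have h5 := hp p hpm
      refine hp' s (left_mem_of_exit hpm ht h1.symm) ?_
      rw [ws]
      exact right_mem_of_exit hx h5 (inj h4.symm)
    · refine hp p hpm ?_
      simpa [swap_apply_of_ne_of_ne hps hpt] using hx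
  · rw [e3, e4]
    exact hm

theorem clearPair_values (h : b ∈ cycOpen a c) :
    (x * swap a b) a = x b ∧ (x * swap a b) b = x a ∧ (x * swap a b) c = x c ∧
    (x * swap b c) b = x c ∧ (x * swap b c) c = x b ∧ (x * swap b c) a = x a ∧
    (x * swap a c) a = x c ∧ (x * swap a c) c = x a ∧ (x * swap a c) b = x b ∧
    (∀ p, p ≠ a → p ≠ b → (x * swap a b) p = x p) ∧
    (∀ p, p ≠ b → p ≠ c → (x * swap b c) p = x p) ∧
    (∀ p, p ≠ a → p ≠ c → (x * swap a c) p = x p) := by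
  obtain ⟨h1, h2, h3⟩ := cycOpen_ne h
  refine ⟨by simp, by simp, ?_, by simp, by simp, ?_, by simp, by simp, ?_, ?_, ?_, ?_⟩
  · simp [swap_apply_of_ne_of_ne h3.symm h2.symm]
  · simp [swap_apply_of_ne_of_ne h1 h3]
  · simp [swap_apply_of_ne_of_ne h1.symm h2]
  all_goals intro p h1 h2; simp [swap_apply_of_ne_of_ne h1 h2]

theorem cyc_facts (h : b ∈ cycOpen a c) :
    (∀ d, d ∈ cyc a c ↔ d ∈ cyc a b ∨ d ∈ cyc b c) ∧
    (∀ d, d ∈ cycOpen a c ↔ d ∈ cycOpen a b ∨ d = b ∨ d ∈ cycOpen b c) ∧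
    (∀ d, d ∈ cycOpen a b → d ∉ cycOpen b c) :=
  ⟨fun _ => cyc_split h, fun _ => cycOpen_split h, fun _ hd => by
    simp only [mem_cycOpen] at *; omega⟩

theorem cycOpen_mem_ne : ∀ p q r : Fin k, p ∈ cycOpen q r → p ≠ q ∧ p ≠ r :=
  fun _ _ _ h => ⟨(cycOpen_ne h).1.symm, (cycOpen_ne h).2.1⟩

/-- The two ways to cut an L-shape with reflex corner on the vertical circle `b` or on the
horizontal circle `x b`. -/
theorem clearPair_iff_of_mem (h : b ∈ cycOpen a c) (hx : x b ∈ cycOpen (x a) (x c)) :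
    (ClearPair Mk x a b a c ↔ ClearPair Mk x b c a b) ∧
      (ClearPair Mk x a b b c ↔ ClearPair Mk x b c a c) := by
  obtain ⟨v1, v2, v3, v4, v5, v6, v7, v8, v9, v10, v11, v12⟩ := clearPair_values (x := x) h
  obtain ⟨h1, h2, h3⟩ := cycOpen_ne h
  obtain ⟨c1, o1, d1⟩ := cyc_facts h
  obtain ⟨c2, o2, d2⟩ := cyc_facts hx
  have n := cycOpen_mem_ne (k := k)
  have inj : ∀ p q, x p = x q → p = q := fun p q h => x.injective h
  simp only [ClearPair, ClearRect, v1, v2, v3, v4, v6]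
  constructor <;> grind

/-- The other two L-shapes: here the reflex corner, `(b, x c)` or `(b, x a)`, is a point of the
final generator instead of a point of `x`. -/
theorem clearPair_iff_of_mem' (h : b ∈ cycOpen a c) (hx : x c ∈ cycOpen (x a) (x b)) :
    (ClearPair Mk x a b b c ↔ ClearPair Mk x a c a b) ∧
      (ClearPair Mk x b c a b ↔ ClearPair Mk x a c b c) := by
  obtain ⟨v1, v2, v3, v4, v5, v6, v7, v8, v9, v10, v11, v12⟩ := clearPair_values (x := x) h
  obtain ⟨h1, h2, h3⟩ := cycOpen_ne h
  obtain ⟨c1, o1, d1⟩ := cyc_facts h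
  obtain ⟨c2, o2, d2⟩ := cyc_facts hx
  obtain ⟨c3, o3, d3⟩ := cyc_facts (cycOpen_rotate (cycOpen_rotate hx))
  have n := cycOpen_mem_ne (k := k)
  have inj : ∀ p q, x p = x q → p = q := fun p q h => x.injective h
  simp only [ClearPair, ClearRect, v2, v3, v4, v6, v7, v8, v9]
  constructor <;> grind

theorem ClearRect.false_of_cover_rows {y : Perm (Fin k)} (hcol : ∀ c, ∃ r, Mk c r)
    (h1 : ClearRect Mk x s t) (h2 : ClearRect Mk y s' t') (hc1 : c ∈ cyc s t)
    (hc2 : c ∈ cyc s' t') (h : ∀ r, r ∈ cyc (x s) (x t) ∨ r ∈ cyc (y s') (y t')) : False := by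
  obtain ⟨r, hr⟩ := hcol c
  rcases h r with hr' | hr'
  · exact h1.2.2 c hc1 r hr' hr
  · exact h2.2.2 c hc2 r hr' hr

theorem ClearRect.false_of_cover_cols {y : Perm (Fin k)} {r : Fin k} (hrow : ∀ r, ∃ c, Mk c r)
    (h1 : ClearRect Mk x s t) (h2 : ClearRect Mk y s' t') (hr1 : r ∈ cyc (x s) (x t))
    (hr2 : r ∈ cyc (y s') (y t')) (h : ∀ c, c ∈ cyc s t ∨ c ∈ cyc s' t') : False := by
  obtain ⟨c, hc⟩ := hrow r
  rcases h c with hc' | hc'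
  · exact h1.2.2 c hc' r hr1 hc
  · exact h2.2.2 c hc' r hr2 hc

/-- The rectangles are stacked along the circle `a`, and their heights add up to more than a full
turn, so they cover the column to its right. -/
theorem not_clearPair_left [NeZero k] (hcol : ∀ c, ∃ r, Mk c r) (hac : a ≠ c)
    (h : x c ∈ cycOpen (x a) (x b)) : ¬ ClearPair Mk x a b a c := by
  rintro ⟨h1, h2⟩
  have hab : a ≠ b := h1.1
  have hbc : b ≠ c := fun e => (cycOpen_ne h).2.1 (by rw [e])
  refine ClearRect.false_of_cover_rows (c := a) hcol h1 h2 (left_mem_cyc hab)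
    (left_mem_cyc hac) fun r => ?_
  have e : (x * swap a b) c = x c := by simp [swap_apply_of_ne_of_ne hac.symm hbc.symm]
  rw [e]
  simpa using cyc_cover h

theorem not_clearPair_right [NeZero k] (hcol : ∀ c, ∃ r, Mk c r) (hac : a ≠ c)
    (h : x a ∈ cycOpen (x b) (x c)) : ¬ ClearPair Mk x b c a c := by
  rintro ⟨h1, h2⟩
  have hbc : b ≠ c := h1.1
  have hab : a ≠ b := fun e => (cycOpen_ne h).1 (by rw [e])
  refine ClearRect.false_of_cover_rows (c := c - 1) hcol h1 h2 (GridDiagram.sub_one_mem_cyc hbc)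
    (GridDiagram.sub_one_mem_cyc hac) fun r => ?_
  have e : (x * swap b c) a = x a := by simp [swap_apply_of_ne_of_ne hab hac]
  rw [e]
  simpa [or_comm] using cyc_cover (cycOpen_rotate h)

/-- The widths add up to more than a full turn, and both rectangles have the circle `x a` as bottom
edge, so they cover the row above it. -/
theorem not_clearPair_wrap_bottom (hrow : ∀ r, ∃ c, Mk c r) (h : b ∈ cycOpen a c) :
    ¬ ClearPair Mk x a c c b := by
  rintro ⟨h1, h2⟩
  obtain ⟨v1, v2, v3, v4, v5, v6, v7, v8, v9, -⟩ := clearPair_values (x := x) h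
  obtain ⟨h12, h23, h13⟩ := cycOpen_ne h
  refine ClearRect.false_of_cover_cols (r := x a) hrow h1 h2
    (left_mem_cyc (x.injective.ne h13)) ?_ fun r => cyc_cover h
  rw [v8, v9]
  exact left_mem_cyc (x.injective.ne h12)

theorem not_clearPair_wrap_top [NeZero k] (hrow : ∀ r, ∃ c, Mk c r) (h : b ∈ cycOpen a c) :
    ¬ ClearPair Mk x c b a c := by
  rintro ⟨h1, h2⟩
  obtain ⟨v1, v2, v3, v4, v5, v6, v7, v8, v9, -⟩ := clearPair_values (x := x) h
  obtain ⟨h12, h23, h13⟩ := cycOpen_ne h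
  rw [swap_comm] at h2
  refine ClearRect.false_of_cover_cols (r := x b - 1) hrow h1 h2
    (GridDiagram.sub_one_mem_cyc (x.injective.ne h23.symm)) ?_ fun r => (cyc_cover h).symm
  rw [v5, v6]
  exact GridDiagram.sub_one_mem_cyc (x.injective.ne h12)

theorem not_clearPair_same (hcol : ∀ c, ∃ r, Mk c r) : ¬ ClearPair Mk x s t s t := by
  rintro ⟨h1, h2⟩
  refine ClearRect.false_of_cover_rows (c := s) hcol h1 h2 (left_mem_cyc h1.1)
    (left_mem_cyc h1.1) fun r => ?_
  have := x.injective.ne h1.1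
  simp [mem_cyc_iff_notMem_cyc this, em']

theorem not_clearPair_reverse (hrow : ∀ r, ∃ c, Mk c r) : ¬ ClearPair Mk x s t t s := by
  rintro ⟨h1, h2⟩
  refine ClearRect.false_of_cover_cols (r := x s) hrow h1 h2
    (left_mem_cyc (x.injective.ne h1.1)) ?_ fun c => ?_
  · simpa using left_mem_cyc (x.injective.ne h1.1)
  · simp [mem_cyc_iff_notMem_cyc h1.1, em']

end ClearRect

/-! ### Markings next to the two curves -/

section CurveConditions

variable {k : ℕ} {c₁ c₂ m h a b c d s t l u a' b' c' d' s' t' l' u' p q r : Fin k}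

open Classical in
/-- The number of elements, modulo two, of a subsingleton given by a proposition. -/
noncomputable def parity (P : Prop) : ZMod 2 := if P then 1 else 0

theorem parity_congr {P Q : Prop} (h : P ↔ Q) : parity P = parity Q := by rw [propext h]

theorem parity_false {P : Prop} (h : ¬ P) : parity P = 0 := if_neg h

theorem parity_add (P Q : Prop) : parity P + parity Q = parity (¬ (P ↔ Q)) := by
  by_cases hP : P <;> by_cases hQ : Q <;> simp [parity, hP, hQ]
  decide

theorem parity_and (P Q : Prop) : parity (P ∧ Q) = parity P * parity Q := by
  by_cases hP : P <;> by_cases hQ : Q <;> simp [parity, hP, hQ]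

/-- A rectangle between the vertical circles `s`, `t` and the horizontal circles `l`, `u` misses
the marking in column `c₁`, just below the circle `h`, and the one in column `c₂`, just above. -/
def MissesMarkings (c₁ c₂ h s t l u : Fin k) : Prop :=
  (h = l → c₂ ∉ cyc s t) ∧ (h = u → c₁ ∉ cyc s t) ∧
    (h ∈ cycOpen l u → c₁ ∉ cyc s t ∧ c₂ ∉ cyc s t)

/-- Moving right from `s` to `t`, one passes the column `m`, not meeting `c₂` before it or `c₁`
after it. -/
def CrossesAt (c₁ c₂ m s t : Fin k) : Prop :=
  m ∈ cyc s t ∧ c₂ ∉ cyc s m ∧ c₁ ∉ cycOpen m t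

/-- The rectangle is the shape of a pentagon with a vertex in column `m`. -/
def IsPentagon (c₁ c₂ m h s t l u : Fin k) : Prop :=
  (h = l ∨ h = u) ∧ CrossesAt c₁ c₂ m s t

/-- The parity of the ways to make one of two consecutive rectangles a pentagon. -/
noncomputable def pentagonParity (c₁ c₂ m h s t l u s' t' l' u' : Fin k) : ZMod 2 :=
  parity (MissesMarkings c₁ c₂ h s t l u ∧ IsPentagon c₁ c₂ m h s' t' l' u') +
    parity (IsPentagon c₁ c₂ m h s t l u ∧ MissesMarkings c₂ c₁ h s' t' l' u')

/-- The crossing lies in one of the two parts. The other part must avoid `c₁` if it is to the right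
of the crossing, and `c₂` if it is to the left. -/
theorem crossesAt_split (h : b ∈ cycOpen a c) :
    CrossesAt c₁ c₂ m a c ↔
      (CrossesAt c₁ c₂ m a b ∧ c₁ ∉ cyc b c) ∨ (CrossesAt c₁ c₂ m b c ∧ c₂ ∉ cyc a b) := by
  simp only [CrossesAt, mem_cyc, mem_cycOpen] at *
  omega

theorem CrossesAt.not_of_mem (h : b ∈ cycOpen a c) (h1 : CrossesAt c₁ c₂ m a b) :
    ¬ CrossesAt c₁ c₂ m b c := fun h2 => cyc_disjoint h h1.1 h2.1

theorem pentagonParity_congr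
    (h : ¬ ((MissesMarkings c₁ c₂ q a b c d ∧ IsPentagon c₁ c₂ m q s t l u) ↔
        (IsPentagon c₁ c₂ m q a b c d ∧ MissesMarkings c₂ c₁ q s t l u)) ↔
      ¬ ((MissesMarkings c₁ c₂ q a' b' c' d' ∧ IsPentagon c₁ c₂ m q s' t' l' u') ↔
        (IsPentagon c₁ c₂ m q a' b' c' d' ∧ MissesMarkings c₂ c₁ q s' t' l' u'))) :
    pentagonParity c₁ c₂ m q a b c d s t l u =
      pentagonParity c₁ c₂ m q a' b' c' d' s' t' l' u' := by
  rw [pentagonParity, pentagonParity, parity_add, parity_add]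
  exact parity_congr h

/-- Both cuts of an L-shape impose the same conditions on the two `X`s, up to the place of the
crossing. The ways need not correspond one to one: if the curve is the cut itself, both rectangles
of one cut may serve as the pentagon, and these two ways cancel. -/
theorem pentagonParity_eq_of_mem (h1 : b ∈ cycOpen a c) (h2 : q ∈ cycOpen p r) :
    pentagonParity c₁ c₂ m h a b p q a c q r = pentagonParity c₁ c₂ m h b c q r a b p r ∧
      pentagonParity c₁ c₂ m h a b p q b c p r = pentagonParity c₁ c₂ m h b c q r a c p q := by
  have hJ := crossesAt_split (c₁ := c₁) (c₂ := c₂) (m := m) h1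
  have hn := CrossesAt.not_of_mem (c₁ := c₁) (c₂ := c₂) (m := m) h1
  have hc1 : c₁ ∈ cyc a c ↔ _ := cyc_split h1
  have hc2 : c₂ ∈ cyc a c ↔ _ := cyc_split h1
  obtain ⟨n1, n2, n3⟩ := cycOpen_ne h2
  have h3 := cycOpen_rotate h2
  have h4 := cycOpen_rotate h3
  have o1 := cycOpen_asymm h2
  have o2 := cycOpen_asymm h3
  have o3 := cycOpen_asymm h4
  have e := fun s t : Fin k => left_notMem_cycOpen (s := s) (t := t)
  have e' := fun s t : Fin k => right_notMem_cycOpen (s := s) (t := t)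
  constructor <;> apply pentagonParity_congr <;>
  simp only [MissesMarkings, IsPentagon, hJ, hc1, hc2] <;>
  by_cases hp : h = p <;> by_cases hq : h = q <;> by_cases hr : h = r <;> grind

theorem pentagonParity_eq_of_mem' (h1 : b ∈ cycOpen a c) (h2 : r ∈ cycOpen p q) :
    pentagonParity c₁ c₂ m h a b p q b c p r = pentagonParity c₁ c₂ m h a c p r a b r q ∧
      pentagonParity c₁ c₂ m h b c q r a b p r = pentagonParity c₁ c₂ m h a c p r b c q p := by
  have hJ := crossesAt_split (c₁ := c₁) (c₂ := c₂) (m := m) h1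
  have hn := CrossesAt.not_of_mem (c₁ := c₁) (c₂ := c₂) (m := m) h1
  have hc1 : c₁ ∈ cyc a c ↔ _ := cyc_split h1
  have hc2 : c₂ ∈ cyc a c ↔ _ := cyc_split h1
  obtain ⟨n1, n2, n3⟩ := cycOpen_ne h2
  have h3 := cycOpen_rotate h2
  have h4 := cycOpen_rotate h3
  have o1 := cycOpen_asymm h2
  have o2 := cycOpen_asymm h3
  have o3 := cycOpen_asymm h4
  have e := fun s t : Fin k => left_notMem_cycOpen (s := s) (t := t)
  have e' := fun s t : Fin k => right_notMem_cycOpen (s := s) (t := t)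
  constructor <;> apply pentagonParity_congr <;>
  simp only [MissesMarkings, IsPentagon, hJ, hc1, hc2] <;>
  by_cases hp : h = p <;> by_cases hq : h = q <;> by_cases hr : h = r <;> grind

end CurveConditions

/-! ### Sums over pairs of rectangles -/

section Sums

variable {k : ℕ} {M : Type*} [AddCommMonoid M]

theorem sum_sum_ite_eq_left (s : Fin k) (g : Fin k → M) :
    (∑ s', ∑ t', if s' = s then g t' else 0) = ∑ t', g t' := by
  rw [Finset.sum_comm]; simp

theorem sum_sum_ite_eq_right (s : Fin k) (g : Fin k → M) :
    (∑ s', ∑ t', if t' = s then g s' else 0) = ∑ t', g t' := by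
  simp

theorem eq_ite_add_ite_cycOpen {a b c : Fin k} {y : M} (h : a = b ∨ b = c ∨ a = c → y = 0) :
    y = (if b ∈ cycOpen a c then y else 0) + (if c ∈ cycOpen a b then y else 0) := by
  by_cases hd : a = b ∨ b = c ∨ a = c
  · simp [h hd]
  · simp only [not_or] at hd
    rcases cycOpen_total hd.1 hd.2.1 hd.2.2 with h | h <;> simp [h, cycOpen_asymm h]

theorem eq_ite_add_ite_cycOpen' {a b c : Fin k} {y : M} (h : a = b ∨ b = c ∨ a = c → y = 0) :
    y = (if b ∈ cycOpen a c then y else 0) + (if a ∈ cycOpen b c then y else 0) := by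
  have : a ∈ cycOpen b c ↔ c ∈ cycOpen a b := cycOpen_rotate_iff
  simp only [this]
  exact eq_ite_add_ite_cycOpen h

theorem sum_congr_comm (g : Fin k → Fin k → Fin k → M) :
    ∑ a, ∑ b, ∑ c, g a b c = ∑ a, ∑ c, ∑ b, g a b c :=
  Finset.sum_congr rfl fun _ _ => Finset.sum_comm

theorem sum_rotate (g : Fin k → Fin k → Fin k → M) :
    ∑ a, ∑ b, ∑ c, g a b c = ∑ b, ∑ c, ∑ a, g a b c := by
  rw [Finset.sum_comm, sum_congr_comm]

/-- The sum of a function over the triples in cyclic order. -/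
def sumCyclic (g : Fin k → Fin k → Fin k → M) : M :=
  ∑ a, ∑ b, ∑ c, if b ∈ cycOpen a c then g a b c else 0

theorem sumCyclic_add (g g' : Fin k → Fin k → Fin k → M) :
    sumCyclic (fun a b c => g a b c + g' a b c) = sumCyclic g + sumCyclic g' := by
  simp only [sumCyclic, ite_add_zero, Finset.sum_add_distrib]

/-- A sum over pairs of pairs of indices vanishes if the terms without a common index cancel in
pairs and, for every triple in cyclic order, the terms with that triple of indices cancel. -/
theorem sum_pairs_eq_zero (f : Fin k → Fin k → Fin k → Fin k → M)
    (h1 : ∀ s s' t', f s s s' t' = 0) (h2 : ∀ s t s', f s t s' s' = 0)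
    (h3 : ∀ s t, f s t s t = 0) (h4 : ∀ s t, f s t t s = 0)
    (hdisj : ∀ s t s' t', s ≠ s' → s ≠ t' → t ≠ s' → t ≠ t' → f s t s' t' + f s' t' s t = 0)
    (htri : ∀ a b c, b ∈ cycOpen a c →
      (f a b a c + f a c a b) + (f b c a c + f a c b c) + (f a b b c + f a c c b) +
        (f b c a b + f c b a c) = 0) :
    ∑ s, ∑ t, ∑ s', ∑ t', f s t s' t' = 0 := by
  -- Once the degenerate, equal and reversed pairs are known to vanish, at most one of the four
  -- coincidences of indices contributes.
  have key : ∀ s t s' t', f s t s' t' =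
      (if s ≠ s' ∧ s ≠ t' ∧ t ≠ s' ∧ t ≠ t' then f s t s' t' else 0) +
      ((if s' = s then f s t s t' else 0) + (if t' = t then f s t s' t else 0) +
      (if s' = t then f s t t t' else 0) + (if t' = s then f s t s' s else 0)) := by
    intro s t s' t'
    by_cases e1 : s = t
    · subst e1; simp [h1]
    by_cases e2 : s' = t'
    · subst e2
      rcases eq_or_ne s' s with rfl | e3
      · simp [h2, e1]
      · rcases eq_or_ne s' t with rfl | e4 <;> simp [*]
    by_cases e3 : s' = s
    · subst e3
      by_cases e4 : t' = t
      · subst e4; simp [h3, e1, Ne.symm e1]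
      · simp [e1, e4, Ne.symm e2]
    by_cases e4 : t' = t
    · subst e4
      simp [e3, e2, Ne.symm e1, Ne.symm e2]
    by_cases e5 : s' = t
    · subst e5
      by_cases e6 : t' = s
      · subst e6; simp [h4, e2, Ne.symm e2]
      · simp [e3, e4, e6]
    by_cases e6 : t' = s
    · subst e6; simp [e2, e4, e5]
    · simp [e3, e4, e5, e6, Ne.symm e3, Ne.symm e4, Ne.symm e5, Ne.symm e6]
  -- Three distinct indices are in one of two cyclic orders; after renaming, both become sums over
  -- triples in cyclic order. The other three coincidences are treated alike.
  have hA : ∑ s, ∑ t, ∑ t', f s t s t' =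
      sumCyclic (fun a b c => f a b a c + f a c a b) := by
    rw [sumCyclic_add, sumCyclic, sumCyclic, ← Finset.sum_add_distrib]
    refine Finset.sum_congr rfl fun s _ => ?_
    rw [Finset.sum_comm (f := fun b c => if b ∈ cycOpen s c then f s c s b else 0)]
    simp only [← Finset.sum_add_distrib]
    refine Finset.sum_congr rfl fun t _ => Finset.sum_congr rfl fun t' _ =>
      eq_ite_add_ite_cycOpen ?_
    rintro (rfl | rfl | rfl) <;> simp [h1, h2, h3]
  have hB : ∑ s, ∑ t, ∑ s', f s t s' t =
      sumCyclic (fun a b c => f b c a c + f a c b c) := by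
    have e1 := sum_rotate fun a b c => if b ∈ cycOpen a c then f b c a c else 0
    have e2 := sum_congr_comm fun a b c => if b ∈ cycOpen a c then f a c b c else 0
    rw [sumCyclic_add, sumCyclic, sumCyclic, e1, e2]
    simp only [← Finset.sum_add_distrib]
    refine Finset.sum_congr rfl fun s _ => Finset.sum_congr rfl fun t _ =>
      Finset.sum_congr rfl fun s' _ => ?_
    rw [add_comm]
    refine eq_ite_add_ite_cycOpen' ?_
    rintro (rfl | rfl | rfl) <;> simp [h1, h2, h3]
  have hC : ∑ s, ∑ t, ∑ t', f s t t t' =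
      sumCyclic (fun a b c => f a b b c + f a c c b) := by
    rw [sumCyclic_add, sumCyclic, sumCyclic, ← Finset.sum_add_distrib]
    refine Finset.sum_congr rfl fun s _ => ?_
    rw [Finset.sum_comm (f := fun b c => if b ∈ cycOpen s c then f s c c b else 0)]
    simp only [← Finset.sum_add_distrib]
    refine Finset.sum_congr rfl fun t _ => Finset.sum_congr rfl fun t' _ =>
      eq_ite_add_ite_cycOpen ?_
    rintro (rfl | rfl | rfl) <;> simp [h1, h2, h4]
  have hD : ∑ s, ∑ t, ∑ s', f s t s' s =
      sumCyclic (fun a b c => f b c a b + f c b a c) := by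
    have e1 := sum_rotate fun a b c => if b ∈ cycOpen a c then f b c a b else 0
    have e2 := (sum_rotate fun a b c => if b ∈ cycOpen a c then f c b a c else 0).trans
      ((sum_rotate _).trans (sum_congr_comm _))
    rw [sumCyclic_add, sumCyclic, sumCyclic, e1, e2]
    simp only [← Finset.sum_add_distrib]
    refine Finset.sum_congr rfl fun s _ => Finset.sum_congr rfl fun t _ =>
      Finset.sum_congr rfl fun s' _ => ?_
    refine eq_ite_add_ite_cycOpen ?_
    rintro (rfl | rfl | rfl) <;> simp [h1, h2, h4]
  have hdis : ∑ s, ∑ t, ∑ s', ∑ t',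
      (if s ≠ s' ∧ s ≠ t' ∧ t ≠ s' ∧ t ≠ t' then f s t s' t' else 0) = 0 := by
    have : ∑ r : (Fin k × Fin k) × (Fin k × Fin k),
        (if r.1.1 ≠ r.2.1 ∧ r.1.1 ≠ r.2.2 ∧ r.1.2 ≠ r.2.1 ∧ r.1.2 ≠ r.2.2 then
          f r.1.1 r.1.2 r.2.1 r.2.2 else 0) = 0 := by
      refine Finset.sum_involution (fun r _ => r.swap) ?_ ?_ ?_ ?_
      · rintro ⟨⟨s, t⟩, s', t'⟩ -
        by_cases h : s ≠ s' ∧ s ≠ t' ∧ t ≠ s' ∧ t ≠ t'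
        · have h' : s' ≠ s ∧ s' ≠ t ∧ t' ≠ s ∧ t' ≠ t :=
            ⟨h.1.symm, h.2.2.1.symm, h.2.1.symm, h.2.2.2.symm⟩
          simp only [Prod.swap, if_pos h, if_pos h']
          exact hdisj _ _ _ _ h.1 h.2.1 h.2.2.1 h.2.2.2
        · have h' : ¬ (s' ≠ s ∧ s' ≠ t ∧ t' ≠ s ∧ t' ≠ t) := fun h' =>
            h ⟨h'.1.symm, h'.2.2.1.symm, h'.2.1.symm, h'.2.2.2.symm⟩
          simp only [Prod.swap, if_neg h, if_neg h', add_zero]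
      · rintro ⟨⟨s, t⟩, s', t'⟩ - h e
        simp only [Prod.swap, Prod.mk.injEq] at e
        simp [e.1.1] at h
      · simp
      · simp
    simpa only [Fintype.sum_prod_type] using this
  have hsum : sumCyclic (fun a b c => (f a b a c + f a c a b) + (f b c a c + f a c b c) +
      (f a b b c + f a c c b) + (f b c a b + f c b a c)) = 0 :=
    Finset.sum_eq_zero fun a _ => Finset.sum_eq_zero fun b _ => Finset.sum_eq_zero fun c _ => by
      split_ifs with h
      · exact htri a b c h
      · rfl
  rw [sumCyclic_add, sumCyclic_add, sumCyclic_add, ← hA, ← hB, ← hC, ← hD] at hsum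
  rw [← hsum]
  calc _ = ∑ s, ∑ t, ∑ s', ∑ t', _ := by
        refine Finset.sum_congr rfl fun s _ => Finset.sum_congr rfl fun t _ =>
          Finset.sum_congr rfl fun s' _ => Finset.sum_congr rfl fun t' _ => key s t s' t'
    _ = _ := by
        simp only [Finset.sum_add_distrib, hdis, zero_add, sum_sum_ite_eq_left,
          sum_sum_ite_eq_right]

end Sums

/-! ### The pentagon map is a chain map -/

/-- A shape `p` determines its target `g p`, so counting shapes for each target amounts to summing
over shapes. -/
theorem sum_single_card {k : ℕ} {ι : Type*} [Fintype ι] (g : ι → Equiv.Perm (Fin k)) (Q : ι → Prop)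
    (S : Equiv.Perm (Fin k) → Finset ι) (hS : ∀ y p, p ∈ S y ↔ y = g p ∧ Q p) :
    (∑ y, Finsupp.single y ((S y).card : ZMod 2) : GridDiagram.Chain k) =
      ∑ p, Finsupp.single (g p) (parity (Q p)) := by
  classical
  have h : ∀ y, ((S y).card : ZMod 2) = ∑ p, parity (y = g p ∧ Q p) := fun y => by
    have e : S y = Finset.univ.filter fun p => y = g p ∧ Q p := by ext p; simp [hS]
    rw [e, Finset.card_filter]
    push_cast
    exact Finset.sum_congr rfl fun p _ => by simp [parity]
  simp only [h, Finsupp.single_finsetSum]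
  rw [Finset.sum_comm]
  refine Finset.sum_congr rfl fun p _ => ?_
  rw [Finset.sum_eq_single (g p)]
  · simp
  · intro y _ hy; simp [hy, parity]
  · simp

/-! ### Rows and columns next to a given circle -/

theorem Fin.val_add_one_eq_ite {k : ℕ} [NeZero k] (a : Fin k) :
    (a + 1).val = if a.val + 1 = k then 0 else a.val + 1 := by
  obtain _ | k := k
  · exact a.elim0
  · rw [Fin.val_add_one]; simp [Fin.ext_iff]

section RowLemmas

variable {k : ℕ} {a b c d m s t : Fin k}

theorem add_one_mem_cyc_iff [NeZero k] (h : a ≠ b) : c + 1 ∈ cyc a b ↔ c + 1 = a ∨ c + 1 ∈ cycOpen a b := by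
  rw [cycOpen, Finset.mem_erase]
  constructor
  · tauto
  · rintro (e | e)
    · rw [e]; exact left_mem_cyc h
    · exact e.2

/-- A row is recognized by its top circle `c + 1`, which may be the upper end of the interval; for
the row above that circle it may be the lower end. -/
theorem mem_cyc_iff_add_one [NeZero k] (h : a ≠ b) : c ∈ cyc a b ↔ c + 1 = b ∨ c + 1 ∈ cycOpen a b := by
  have hval := Fin.val_add_one_eq_ite c
  rw [Ne, Fin.ext_iff] at h
  have := c.isLt
  simp only [mem_cyc, mem_cycOpen, Fin.ext_iff]
  split_ifs at hval <;> omega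

theorem mem_cyc_add_one_iff [NeZero k] (h : m ∈ cyc s t) : d ∈ cyc (m + 1) t ↔ d ∈ cycOpen m t := by
  have hval := Fin.val_add_one_eq_ite m
  have := m.isLt
  have := d.isLt
  simp only [mem_cyc, mem_cycOpen] at *
  split_ifs at hval <;> omega

theorem mem_cyc_iff_of_mem (h : m ∈ cyc s t) :
    d ∈ cyc s t ↔ d ∈ cyc s m ∨ d = m ∨ d ∈ cycOpen m t := by
  simp only [mem_cyc, mem_cycOpen, Fin.ext_iff] at *
  omega

end RowLemmas

open Equiv

/-! ### Rectangles and pentagons relative to the outer markings -/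

namespace CombinedDiagram

variable {k : ℕ} [NeZero k] (D : CombinedDiagram k)

/-- The index of the curves `β` and `γ` among the horizontal circles. -/
def curve : Fin k := D.row + 1

/-- The column of the `X` below `β`. -/
def lowerCol : Fin k := D.Gβ.X.symm D.row

/-- The column of the `X` above `β`. -/
def upperCol : Fin k := D.Gβ.X.symm (D.row + 1)

/-- The markings outside of the two bigons. -/
def OuterMarking (c r : Fin k) : Prop :=
  r = D.Gβ.O c ∨ (r = D.Gβ.X c ∧ c ≠ D.lowerCol ∧ c ≠ D.upperCol)

theorem exists_outerMarking_row (c : Fin k) : ∃ r, D.OuterMarking c r := ⟨_, Or.inl rfl⟩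

theorem exists_outerMarking_col (r : Fin k) : ∃ c, D.OuterMarking c r :=
  ⟨D.Gβ.O.symm r, Or.inl (by simp)⟩

theorem X_lowerCol : D.Gβ.X D.lowerCol = D.row := by simp [lowerCol]

theorem X_upperCol : D.Gβ.X D.upperCol = D.row + 1 := by simp [upperCol]

theorem Xγ_lowerCol : D.Gγ.X D.lowerCol = D.row + 1 := by simp [lowerCol, D.X_eq]

theorem Xγ_upperCol : D.Gγ.X D.upperCol = D.row := by simp [upperCol, D.X_eq]

theorem Xγ_of_ne {c : Fin k} (h1 : c ≠ D.lowerCol) (h2 : c ≠ D.upperCol) :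
    D.Gγ.X c = D.Gβ.X c := by
  rw [D.X_eq, Perm.mul_apply, swap_apply_of_ne_of_ne]
  · rintro h; exact h1 (by simp [lowerCol, ← h])
  · rintro h; exact h2 (by simp [upperCol, ← h])

theorem forall_mem_cyc_outer {s t l u : Fin k} :
    (∀ c ∈ cyc s t, ∀ r ∈ cyc l u, ¬ D.OuterMarking c r) ↔
      (∀ c ∈ cyc s t, D.Gβ.O c ∉ cyc l u) ∧
        ∀ c ∈ cyc s t, c ≠ D.lowerCol → c ≠ D.upperCol → D.Gβ.X c ∉ cyc l u := by
  simp only [OuterMarking]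
  grind

theorem missesMarkings_iff {c₁ c₂ s t l u : Fin k} (h : l ≠ u) :
    MissesMarkings c₁ c₂ D.curve s t l u ↔
      (D.row ∈ cyc l u → c₁ ∉ cyc s t) ∧ (D.row + 1 ∈ cyc l u → c₂ ∉ cyc s t) := by
  rw [mem_cyc_iff_add_one h, add_one_mem_cyc_iff h, MissesMarkings, curve]
  tauto

theorem mem_rect_β {x y : Perm (Fin k)} {p : Fin k × Fin k} :
    p ∈ D.Gβ.rect x y ↔ y = x * swap p.1 p.2 ∧ ClearRect D.OuterMarking x p.1 p.2 ∧
      MissesMarkings D.lowerCol D.upperCol D.curve p.1 p.2 (x p.1) (x p.2) := by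
  obtain ⟨s, t⟩ := p
  simp only [GridDiagram.rect, Finset.mem_filter, Finset.mem_univ, true_and, ClearRect,
    forall_mem_cyc_outer]
  by_cases hst : s = t
  · simp [hst]
  rw [missesMarkings_iff D (x.injective.ne hst)]
  have := D.X_lowerCol
  have := D.X_upperCol
  grind

theorem mem_rect_γ {x y : Perm (Fin k)} {p : Fin k × Fin k} :
    p ∈ D.Gγ.rect x y ↔ y = x * swap p.1 p.2 ∧ ClearRect D.OuterMarking x p.1 p.2 ∧
      MissesMarkings D.upperCol D.lowerCol D.curve p.1 p.2 (x p.1) (x p.2) := by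
  obtain ⟨s, t⟩ := p
  simp only [GridDiagram.rect, Finset.mem_filter, Finset.mem_univ, true_and, ClearRect,
    forall_mem_cyc_outer, D.O_eq]
  by_cases hst : s = t
  · simp [hst]
  rw [missesMarkings_iff D (x.injective.ne hst)]
  have := D.Xγ_lowerCol
  have := D.Xγ_upperCol
  have := fun c => D.Xγ_of_ne (c := c)
  grind

/-- Of the two special `X`s, only the upper one can be in the region left of the crossing, and only
the lower one right of it. In the column of the crossing neither is in the region for both diagrams,
so that column gives no condition on them. The hypotheses fit pentagons above the curves as well as
below. -/
theorem empty_iff {x : Perm (Fin k)} {s t : Fin k} {Gl Gr : GridDiagram k} (hst : s ≠ t)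
    (hm : D.cross ∈ cyc s t)
    (hl : ∀ c, c ≠ D.lowerCol → c ≠ D.upperCol → Gl.X c = D.Gβ.X c)
    (hr : ∀ c, c ≠ D.lowerCol → c ≠ D.upperCol → Gr.X c = D.Gβ.X c)
    (hl1 : Gl.X D.lowerCol ∉ cyc (x s) (x t)) (hl2 : Gl.X D.upperCol ∈ cyc (x s) (x t))
    (hr1 : Gr.X D.lowerCol ∈ cyc (x s) (x t)) (hr2 : Gr.X D.upperCol ∉ cyc (x s) (x t)) :
    D.Empty x Gl Gr s t (x s) (x t) ↔
      ClearRect D.OuterMarking x s t ∧ CrossesAt D.lowerCol D.upperCol D.cross s t := by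
  simp only [Empty, ClearRect, CrossesAt, forall_mem_cyc_outer]
  simp only [mem_cyc_add_one_iff hm, mem_cyc_iff_of_mem hm]
  have n : ∀ s t : Fin k, t ∉ cyc s t := fun s t => right_notMem_cyc
  have n' : ∀ s t : Fin k, s ∉ cycOpen s t := fun s t => left_notMem_cycOpen
  grind

/-- The pentagons as rectangles. -/
theorem mem_pent {x y : Perm (Fin k)} {v : Fin k} :
    v ∈ D.pent x y ↔ y = x * swap (x.symm D.curve) v ∧
      ¬ ((ClearRect D.OuterMarking x (x.symm D.curve) v ∧
          IsPentagon D.lowerCol D.upperCol D.cross D.curve (x.symm D.curve) v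
            (x (x.symm D.curve)) (x v)) ↔
        (ClearRect D.OuterMarking x v (x.symm D.curve) ∧
          IsPentagon D.lowerCol D.upperCol D.cross D.curve v (x.symm D.curve)
            (x v) (x (x.symm D.curve)))) := by
  simp only [pent, Finset.mem_filter, Finset.mem_univ, true_and, IsPentagon]
  obtain ⟨u, hu⟩ : ∃ u, u = x.symm D.curve := ⟨_, rfl⟩
  have hxu : x u = D.row + 1 := by rw [hu]; simp [curve]
  have hu' : x.symm (D.row + 1) = u := hu.symm
  rw [hu', ← hu]
  by_cases huv : v = u
  · subst huv; simp
  have hne : x u ≠ x v := x.injective.ne (Ne.symm huv)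
  have h1 : D.row + 1 ∈ cyc (x u) (x v) := by rw [← hxu]; exact left_mem_cyc hne
  have h2 : D.row ∈ cyc (x v) (x u) := (mem_cyc_iff_add_one hne.symm).mpr (Or.inl hxu.symm)
  have h3 := (mem_cyc_iff_notMem_cyc hne).mp h1
  have h4 := (mem_cyc_iff_notMem_cyc hne.symm).mp h2
  have hβ : ∀ c, c ≠ D.lowerCol → c ≠ D.upperCol → D.Gβ.X c = D.Gβ.X c := fun _ _ _ => rfl
  have hγ : ∀ c, c ≠ D.lowerCol → c ≠ D.upperCol → D.Gγ.X c = D.Gβ.X c := fun _ => D.Xγ_of_ne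
  have hxu' : D.curve = x u := hxu.symm
  split_ifs with hm
  · have hm' := (mem_cyc_iff_notMem_cyc (Ne.symm huv)).mp hm
    have key := D.empty_iff (x := x) (Ne.symm huv) hm hβ hγ (by rwa [X_lowerCol])
      (by rwa [X_upperCol]) (by rwa [Xγ_lowerCol]) (by rwa [Xγ_upperCol])
    rw [hxu] at key
    rw [key]
    -- The crossing is in the columns from `u` to `v`, so the complementary columns give no pentagon
    -- and the exclusive alternative has one side left.
    have hn : ¬ CrossesAt D.lowerCol D.upperCol D.cross v u := fun h => hm' h.1
    simp only [hn, hxu', true_or, true_and, and_false, iff_false, not_not, ne_eq, huv,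
      not_false_eq_true]
  · have hm' := (mem_cyc_iff_notMem_cyc huv).mpr hm
    have key := D.empty_iff (x := x) huv hm' hγ hβ (by rwa [Xγ_lowerCol])
      (by rwa [Xγ_upperCol]) (by rwa [X_lowerCol]) (by rwa [X_upperCol])
    rw [hxu] at key
    rw [key]
    have hn : ¬ CrossesAt D.lowerCol D.upperCol D.cross u v := fun h => hm h.1
    simp only [hn, hxu', or_true, true_and, and_false, false_iff, not_not, ne_eq, huv,
      not_false_eq_true]

theorem bd_β_single (x : Perm (Fin k)) :
    D.Gβ.bd (Finsupp.single x 1) = ∑ s, ∑ t, Finsupp.single (x * swap s t)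
      (parity (ClearRect D.OuterMarking x s t ∧
        MissesMarkings D.lowerCol D.upperCol D.curve s t (x s) (x t))) := by
  rw [GridDiagram.bd, Finsupp.linearCombination_single, one_smul,
    sum_single_card _ _ _ fun y p => D.mem_rect_β, Fintype.sum_prod_type]

theorem bd_γ_single (x : Perm (Fin k)) :
    D.Gγ.bd (Finsupp.single x 1) = ∑ s, ∑ t, Finsupp.single (x * swap s t)
      (parity (ClearRect D.OuterMarking x s t ∧
        MissesMarkings D.upperCol D.lowerCol D.curve s t (x s) (x t))) := by
  rw [GridDiagram.bd, Finsupp.linearCombination_single, one_smul,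
    sum_single_card _ _ _ fun y p => D.mem_rect_γ, Fintype.sum_prod_type]

theorem phi_single (x : Perm (Fin k)) :
    D.phi (Finsupp.single x 1) = ∑ s, ∑ t, Finsupp.single (x * swap s t)
      (parity (ClearRect D.OuterMarking x s t ∧
        IsPentagon D.lowerCol D.upperCol D.cross D.curve s t (x s) (x t))) := by
  rw [phi, Finsupp.linearCombination_single, one_smul, sum_single_card _ _ _ fun y p => D.mem_pent]
  simp only [← parity_add, Finsupp.single_add, Finset.sum_add_distrib]
  obtain ⟨u, hu⟩ : ∃ u, u = x.symm D.curve := ⟨_, rfl⟩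
  rw [← hu]
  have hxu : ∀ v, D.curve = x v ↔ v = u := fun v => by
    rw [hu, Equiv.eq_symm_apply, eq_comm]
  -- A pentagon has an edge on the curve, so one of its vertical circles is `u`, the one where `x`
  -- meets the curve.
  have key : ∀ s t, (Finsupp.single (x * swap s t)
      (parity (ClearRect D.OuterMarking x s t ∧
        IsPentagon D.lowerCol D.upperCol D.cross D.curve s t (x s) (x t))) :
        GridDiagram.Chain k) =
      (if s = u then Finsupp.single (x * swap u t)
        (parity (ClearRect D.OuterMarking x u t ∧
        IsPentagon D.lowerCol D.upperCol D.cross D.curve u t (x u) (x t))) else 0) +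
      (if t = u then Finsupp.single (x * swap u s)
        (parity (ClearRect D.OuterMarking x s u ∧
        IsPentagon D.lowerCol D.upperCol D.cross D.curve s u (x s) (x u))) else 0) := by
    intro s t
    by_cases hs : s = u
    · subst hs
      by_cases ht : t = s
      · subst ht
        simp [ClearRect, parity]
      · simp [ht]
    · by_cases ht : t = u
      · subst ht
        simp [hs, swap_comm]
      · simp [IsPentagon, hxu, hs, ht, parity]
  rw [Finset.sum_congr rfl fun s _ => Finset.sum_congr rfl fun t _ => key s t]
  simp only [Finset.sum_add_distrib]
  congr 1
  · rw [Finset.sum_comm]; simp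
  · simp

end CombinedDiagram

/-! ### Cancellation of the contributions in pairs -/

theorem swap_mul_swap_rotate {α : Type*} [DecidableEq α] {a b c : α} (h1 : a ≠ b) (h2 : b ≠ c)
    (h3 : a ≠ c) : swap a b * swap a c = swap b c * swap a b := by
  ext p
  simp only [Perm.mul_apply, swap_apply_def]
  split_ifs <;> simp_all

theorem missesMarkings_comm {k : ℕ} {c₁ c₂ h s t l u : Fin k} (h1 : h ≠ l) (h2 : h ≠ u) :
    MissesMarkings c₁ c₂ h s t l u ↔ MissesMarkings c₂ c₁ h s t l u := by
  simp only [MissesMarkings, h1, h2]; tauto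

/-- The pentagon has an edge on the curve, so the other rectangle, whose edges are on other circles,
has the curve in its interior or not at all. Its condition is then the same for `β` and for `γ`. -/
theorem pentagonParity_comm {k : ℕ} {c₁ c₂ m h s t l u s' t' l' u' : Fin k}
    (h1 : l ≠ l') (h2 : l ≠ u') (h3 : u ≠ l') (h4 : u ≠ u') :
    pentagonParity c₁ c₂ m h s t l u s' t' l' u' =
      pentagonParity c₁ c₂ m h s' t' l' u' s t l u := by
  rw [pentagonParity, pentagonParity, add_comm]
  congr 1
  · refine parity_congr ⟨fun ⟨hp, hm⟩ => ⟨?_, hp⟩, fun ⟨hm, hp⟩ => ⟨hp, ?_⟩⟩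
    · rcases hp.1 with rfl | rfl
      · exact (missesMarkings_comm h1 h2).mpr hm
      · exact (missesMarkings_comm h3 h4).mpr hm
    · rcases hp.1 with rfl | rfl
      · exact (missesMarkings_comm h1 h2).mp hm
      · exact (missesMarkings_comm h3 h4).mp hm
  · refine parity_congr ⟨fun ⟨hm, hp⟩ => ⟨hp, ?_⟩, fun ⟨hp, hm⟩ => ⟨?_, hp⟩⟩
    · rcases hp.1 with rfl | rfl
      · exact (missesMarkings_comm h1.symm h3.symm).mp hm
      · exact (missesMarkings_comm h2.symm h4.symm).mp hm
    · rcases hp.1 with rfl | rfl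
      · exact (missesMarkings_comm h1.symm h3.symm).mpr hm
      · exact (missesMarkings_comm h2.symm h4.symm).mpr hm

namespace CombinedDiagram

variable {k : ℕ} [NeZero k] (D : CombinedDiagram k) (x : Perm (Fin k))

/-- The contribution to `φ ∂ x + ∂ φ x` of the pair of consecutive rectangles `(s, t)`, `(s', t')`,
one of which is to be a pentagon. -/
noncomputable def pairTerm (s t s' t' : Fin k) : GridDiagram.Chain k :=
  Finsupp.single (x * swap s t * swap s' t')
    (parity (ClearPair D.OuterMarking x s t s' t') *
      pentagonParity D.lowerCol D.upperCol D.cross D.curve s t (x s) (x t) s' t'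
        ((x * swap s t) s') ((x * swap s t) t'))

theorem phi_bd_add_bd_phi :
    D.phi (D.Gβ.bd (Finsupp.single x 1)) + D.Gγ.bd (D.phi (Finsupp.single x 1)) =
      ∑ s, ∑ t, ∑ s', ∑ t', D.pairTerm x s t s' t' := by
  have e : ∀ (f : GridDiagram.Chain k →ₗ[ZMod 2] GridDiagram.Chain k) (y : Perm (Fin k))
      (r : ZMod 2), f (Finsupp.single y r) = r • f (Finsupp.single y 1) := fun f y r => by
    rw [← map_smul, Finsupp.smul_single_one]
  rw [bd_β_single, phi_single]
  simp only [map_sum]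
  simp only [← Finset.sum_add_distrib]
  refine Finset.sum_congr rfl fun s _ => Finset.sum_congr rfl fun t _ => ?_
  rw [e D.phi, e D.Gγ.bd, phi_single, bd_γ_single]
  simp only [Finset.smul_sum, Finsupp.smul_single, smul_eq_mul, ← Finset.sum_add_distrib,
    ← Finsupp.single_add]
  refine Finset.sum_congr rfl fun s' _ => Finset.sum_congr rfl fun t' _ => ?_
  rw [pairTerm, ClearPair, pentagonParity]
  simp only [parity_and]
  congr 1
  ring

variable {x}

theorem pairTerm_eq_zero {s t s' t' : Fin k} (h : ¬ ClearPair D.OuterMarking x s t s' t') :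
    D.pairTerm x s t s' t' = 0 := by
  rw [pairTerm, parity_false h, zero_mul, Finsupp.single_zero]

theorem pairTerm_comm {s t s' t' : Fin k} (h1 : s ≠ s') (h2 : s ≠ t') (h3 : t ≠ s')
    (h4 : t ≠ t') : D.pairTerm x s t s' t' = D.pairTerm x s' t' s t := by
  have e1 : (x * swap s t) s' = x s' := by simp [swap_apply_of_ne_of_ne h1.symm h3.symm]
  have e2 : (x * swap s t) t' = x t' := by simp [swap_apply_of_ne_of_ne h2.symm h4.symm]
  have e3 : (x * swap s' t') s = x s := by simp [swap_apply_of_ne_of_ne h1 h2]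
  have e4 : (x * swap s' t') t = x t := by simp [swap_apply_of_ne_of_ne h3 h4]
  have hc : swap s t * swap s' t' = swap s' t' * swap s t := by
    ext p
    simp only [Perm.mul_apply, swap_apply_def]
    split_ifs <;> simp_all
  have hinj := fun a b (h : a ≠ b) => x.injective.ne h
  rw [pairTerm, pairTerm, e1, e2, e3, e4, mul_assoc, hc, ← mul_assoc,
    pentagonParity_comm (hinj _ _ h1) (hinj _ _ h2) (hinj _ _ h3) (hinj _ _ h4)]
  congr 2
  exact parity_congr ⟨.comm_of_disjoint h1 h2 h3 h4,
    .comm_of_disjoint h1.symm h3.symm h2.symm h4.symm⟩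

theorem pairTerm_eq_of_mem {a b c : Fin k} (h : b ∈ cycOpen a c)
    (hx : x b ∈ cycOpen (x a) (x c)) :
    D.pairTerm x a b a c = D.pairTerm x b c a b ∧ D.pairTerm x a b b c = D.pairTerm x b c a c := by
  obtain ⟨v1, v2, v3, v4, v5, v6, v7, v8, v9, -⟩ := clearPair_values (x := x) h
  obtain ⟨h1, h2, h3⟩ := cycOpen_ne h
  obtain ⟨c1, c2⟩ := clearPair_iff_of_mem (Mk := D.OuterMarking) h hx
  obtain ⟨p1, p2⟩ := pentagonParity_eq_of_mem (c₁ := D.lowerCol) (c₂ := D.upperCol)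
    (m := D.cross) (h := D.curve) h hx
  have s1 := swap_mul_swap_rotate h1 h2 h3
  have s2 := swap_mul_swap_rotate h2.symm h1.symm h3.symm
  rw [swap_comm c b, swap_comm c a, swap_comm b a] at s2
  simp only [pairTerm, v1, v2, v3, v4, v5, v6, mul_assoc, s1, s2, p1, p2, propext c1, propext c2,
    and_self]

theorem pairTerm_eq_of_mem' {a b c : Fin k} (h : b ∈ cycOpen a c)
    (hx : x c ∈ cycOpen (x a) (x b)) :
    D.pairTerm x a b b c = D.pairTerm x a c a b ∧ D.pairTerm x b c a b = D.pairTerm x a c b c := by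
  obtain ⟨v1, v2, v3, v4, v5, v6, v7, v8, v9, -⟩ := clearPair_values (x := x) h
  obtain ⟨h1, h2, h3⟩ := cycOpen_ne h
  obtain ⟨c1, c2⟩ := clearPair_iff_of_mem' (Mk := D.OuterMarking) h hx
  obtain ⟨p1, p2⟩ := pentagonParity_eq_of_mem' (c₁ := D.lowerCol) (c₂ := D.upperCol)
    (m := D.cross) (h := D.curve) h hx
  have s1 := swap_mul_swap_rotate h1.symm h3 h2
  have s2 := swap_mul_swap_rotate h2 h3.symm h1.symm
  rw [swap_comm b a] at s1
  rw [swap_comm b a, swap_comm c a] at s2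
  simp only [pairTerm, v2, v3, v4, v6, v7, v8, v9, mul_assoc, s1, s2, p1, p2, propext c1,
    propext c2, and_self]

theorem phi_comp_bd : D.phi ∘ₗ D.Gβ.bd = D.Gγ.bd ∘ₗ D.phi := by
  have two : ∀ y : GridDiagram.Chain k, y + y = 0 := ZModModule.add_self
  have hrow := D.exists_outerMarking_row
  have hcol := D.exists_outerMarking_col
  refine Finsupp.lhom_ext' fun x => LinearMap.ext_ring ?_
  simp only [LinearMap.comp_apply, Finsupp.lsingle_apply]
  have key : ∑ s, ∑ t, ∑ s', ∑ t', D.pairTerm x s t s' t' = 0 := by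
    apply sum_pairs_eq_zero
    · exact fun s s' t' => D.pairTerm_eq_zero fun h => h.1.1 rfl
    · exact fun s s' t' => D.pairTerm_eq_zero fun h => h.2.1 rfl
    · exact fun s t => D.pairTerm_eq_zero (not_clearPair_same hrow)
    · exact fun s t => D.pairTerm_eq_zero (not_clearPair_reverse hcol)
    · intro s t s' t' h1 h2 h3 h4
      rw [D.pairTerm_comm h1 h2 h3 h4, two]
    · intro a b c h
      obtain ⟨h1, h2, h3⟩ := cycOpen_ne h
      have z1 : D.pairTerm x a c c b = 0 :=
        D.pairTerm_eq_zero (not_clearPair_wrap_bottom hcol h)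
      have z2 : D.pairTerm x c b a c = 0 := D.pairTerm_eq_zero (not_clearPair_wrap_top hcol h)
      -- In either cyclic order of the three horizontal circles, four of the eight pairs cover a
      -- column or a row and the other four are two L-shapes, each cut in two ways.
      rcases cycOpen_total (x.injective.ne h1) (x.injective.ne h2) (x.injective.ne h3) with
        hx | hx
      · obtain ⟨e1, e2⟩ := D.pairTerm_eq_of_mem h hx
        have z3 : D.pairTerm x a c a b = 0 := D.pairTerm_eq_zero (not_clearPair_left hrow h1 hx)
        have z4 : D.pairTerm x a c b c = 0 :=
          D.pairTerm_eq_zero (not_clearPair_right hrow h2 hx)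
        rw [z1, z2, z3, z4, e1, e2]
        simp only [add_zero]
        rw [add_assoc, add_comm (D.pairTerm x b c a c) (D.pairTerm x b c a b), two]
      · obtain ⟨e1, e2⟩ := D.pairTerm_eq_of_mem' h hx
        have z3 : D.pairTerm x a b a c = 0 := D.pairTerm_eq_zero (not_clearPair_left hrow h3 hx)
        have z4 : D.pairTerm x b c a c = 0 := D.pairTerm_eq_zero
          (not_clearPair_right hrow h3 (cycOpen_rotate (cycOpen_rotate hx)))
        rw [z1, z2, z3, z4, e1, e2]
        simp only [add_zero, zero_add]
        rw [add_assoc, two]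
  rw [← sub_eq_zero, ZModModule.sub_eq_add, phi_bd_add_bd_phi, key]

end CombinedDiagram

/-! ### The image of `z⁺` under the pentagon map -/

theorem mem_cyc_add_one_self {k : ℕ} [NeZero k] {a c : Fin k} (h : a ≠ a + 1) :
    c ∈ cyc a (a + 1) ↔ c = a := by
  have hval := Fin.val_add_one_eq_ite a
  have := a.isLt
  have := c.isLt
  rw [Ne, Fin.ext_iff] at h
  simp only [mem_cyc, Fin.ext_iff]
  split_ifs at hval <;> omega

theorem notMem_cycOpen_add_one_self {k : ℕ} [NeZero k] {a c : Fin k} (h : a ≠ a + 1) :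
    c ∉ cycOpen a (a + 1) := by
  rw [cycOpen, Finset.mem_erase, mem_cyc_add_one_self h]
  tauto

/-- In a grid of one square, the `O` and the `X` would coincide. -/
theorem GridDiagram.ne_add_one {k : ℕ} [NeZero k] (G : GridDiagram k) (a : Fin k) :
    a ≠ a + 1 := fun h => by
  have h1 : (1 : Fin k) = 0 := by simpa using h.symm
  have h2 : ∀ c : Fin k, c = 0 := fun c => by rw [← mul_one c, h1, mul_zero]
  exact G.disjoint 0 ((h2 _).trans (h2 _).symm)

namespace CombinedDiagram

variable {k : ℕ} [NeZero k] (D : CombinedDiagram k)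

theorem lowerCol_ne_upperCol : D.lowerCol ≠ D.upperCol := fun h =>
  D.Gβ.ne_add_one D.row (D.Gβ.X.symm.injective h)

theorem zPlus_apply (G : GridDiagram k) (c : Fin k) : G.zPlus c = G.X (c - 1) + 1 := by
  simp [GridDiagram.zPlus]

theorem zPlus_γ :
    D.Gγ.zPlus = D.Gβ.zPlus * swap (D.lowerCol + 1) (D.upperCol + 1) := by
  have hn := D.lowerCol_ne_upperCol
  ext c
  rw [Perm.mul_apply, zPlus_apply, zPlus_apply]
  by_cases h1 : c = D.lowerCol + 1
  · subst h1; simp [Xγ_lowerCol, X_upperCol]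
  by_cases h2 : c = D.upperCol + 1
  · subst h2; simp [Xγ_upperCol, X_lowerCol]
  rw [swap_apply_of_ne_of_ne h1 h2, D.Xγ_of_ne]
  · rintro h; exact h1 (by simp [← h])
  · rintro h; exact h2 (by simp [← h])

/-- The `X` in the upper right square must be one of the two special ones, which fixes `t`. The edge
on the curve then fixes `s`. Conversely, the strip meets only the row above the curve, where the
only outer marking is the `O` excluded by `hO`. -/
theorem pentagon_zPlus_iff (hcross : D.cross = D.upperCol)
    (hO : D.Gβ.O.symm (D.row + 1) ∉ cyc (D.lowerCol + 1) (D.upperCol + 1)) (s t : Fin k) :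
    (ClearRect D.OuterMarking D.Gβ.zPlus s t ∧
      IsPentagon D.lowerCol D.upperCol D.cross D.curve s t (D.Gβ.zPlus s) (D.Gβ.zPlus t)) ↔
      s = D.lowerCol + 1 ∧ t = D.upperCol + 1 := by
  have hn := D.lowerCol_ne_upperCol
  rw [hcross]
  constructor
  · rintro ⟨⟨hst, -, hm⟩, hh, hc1, hc2, hc3⟩
    have ht1 := GridDiagram.sub_one_mem_cyc hst
    have hX : D.Gβ.X (t - 1) ∈ cyc (D.Gβ.zPlus s) (D.Gβ.zPlus t) := by
      have e : D.Gβ.X (t - 1) = D.Gβ.zPlus t - 1 := by simp [zPlus_apply]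
      rw [e]
      exact GridDiagram.sub_one_mem_cyc (D.Gβ.zPlus.injective.ne hst)
    have ht : t = D.upperCol + 1 := by
      by_contra ht
      have ht2 : t - 1 ≠ D.upperCol := fun e => ht (by simp [← e])
      -- The `X` cannot be the lower one either: it is in the last column, to the right of the
      -- crossing, where the lower `X` is forbidden.
      refine hm _ ht1 _ hX (Or.inr ⟨rfl, fun e => hc3 ?_, ht2⟩)
      rw [mem_cyc_iff_of_mem hc1] at ht1
      rcases ht1 with h | h | h
      · exfalso
        have hu : D.upperCol ≠ t := fun e => right_notMem_cyc (e ▸ hc1)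
        have := GridDiagram.sub_one_mem_cyc hu
        simp only [mem_cyc] at *
        omega
      · exact absurd h ht2
      · rwa [← e]
    refine ⟨?_, ht⟩
    subst ht
    -- The top edge is one circle above the curve, so the edge on the curve is the bottom one.
    have hs : D.curve = D.Gβ.zPlus s := by
      refine hh.resolve_right fun e => ?_
      rw [zPlus_apply, add_sub_cancel_right, X_upperCol] at e
      exact D.Gβ.ne_add_one _ e
    rw [zPlus_apply, curve, add_left_inj, ← X_lowerCol, D.Gβ.X.injective.eq_iff] at hs
    rw [hs, sub_add_cancel]
  · rintro ⟨rfl, rfl⟩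
    have hst : D.lowerCol + 1 ≠ D.upperCol + 1 := fun h => hn (add_right_cancel h)
    have e1 : D.Gβ.zPlus (D.lowerCol + 1) = D.row + 1 := by simp [zPlus_apply, X_lowerCol]
    have e2 : D.Gβ.zPlus (D.upperCol + 1) = D.row + 1 + 1 := by simp [zPlus_apply, X_upperCol]
    refine ⟨⟨hst, ?_, ?_⟩, Or.inl ?_, ?_, right_notMem_cyc, ?_⟩
    · intro c _
      rw [e1, e2]
      exact notMem_cycOpen_add_one_self (D.Gβ.ne_add_one _)
    · rw [e1, e2]
      intro c hc r hr
      rw [mem_cyc_add_one_self (D.Gβ.ne_add_one _)] at hr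
      subst hr
      rintro (h | ⟨h, -, h2⟩)
      · refine hO ?_
        rwa [h, symm_apply_apply]
      · exact h2 (by rw [upperCol, h, symm_apply_apply])
    · rw [e1, curve]
    · simpa using GridDiagram.sub_one_mem_cyc hst
    · exact notMem_cycOpen_add_one_self (D.Gβ.ne_add_one _)

theorem phi_zPlus (hcross : D.cross = D.upperCol)
    (hO : D.Gβ.O.symm (D.row + 1) ∉ cyc (D.lowerCol + 1) (D.upperCol + 1)) :
    D.phi (Finsupp.single D.Gβ.zPlus 1) = Finsupp.single D.Gγ.zPlus 1 := by
  rw [phi_single, zPlus_γ]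
  simp only [D.pentagon_zPlus_iff hcross hO]
  rw [Finset.sum_eq_single (D.lowerCol + 1), Finset.sum_eq_single (D.upperCol + 1)]
  · simp [parity]
  · intro t _ ht; simp [parity, ht]
  · simp
  · intro s _ hs; simp [parity, hs]
  · simp

theorem homologyMap_theta (hcross : D.cross = D.upperCol)
    (hO : D.Gβ.O.symm (D.row + 1) ∉ cyc (D.lowerCol + 1) (D.upperCol + 1)) :
    GridDiagram.homologyMap D.phi D.phi_comp_bd D.Gβ.theta = D.Gγ.theta := by
  rw [GridDiagram.homologyMap, GridDiagram.theta, GridDiagram.theta, Submodule.mapQ_apply]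
  congr 1
  exact Subtype.ext (D.phi_zPlus hcross hO)

end CombinedDiagram

/-! ### Grid diagrams of braid words

The columns are indexed by pairs of a position `p` and a time `t`, in the lexicographic order of
`(p, f t)`, and the rows by pairs of a time and a position, in the lexicographic order. At time `t`
the strands run along the columns `(p, t)`, and row `(t, p)` moves a strand from the column `(p, t)`
to the column `(π t p, t + 1)`. -/

theorem add_mul_lt_iff {n a b s t : ℕ} (ha : a < n) (hb : b < n) :
    a + n * s < b + n * t ↔ s < t ∨ (s = t ∧ a < b) := by
  rcases lt_trichotomy s t with h | rfl | h
  · have : n * (s + 1) ≤ n * t := Nat.mul_le_mul_left n h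
    rw [mul_add] at this
    omega
  · omega
  · have : n * (t + 1) ≤ n * s := Nat.mul_le_mul_left n h
    rw [mul_add] at this
    omega

theorem List.flatten_ofFn_of_eq_nil {α : Type*} {n : ℕ} (g : Fin n → List α) (j : Fin n)
    (h : ∀ i, i ≠ j → g i = []) : (List.ofFn g).flatten = g j := by
  induction n with
  | zero => exact j.elim0
  | succ n ih =>
    rw [List.ofFn_succ, List.flatten_cons]
    induction j using Fin.cases with
    | zero =>
      rw [List.flatten_eq_nil_iff.mpr, List.append_nil]
      simp only [List.forall_mem_ofFn_iff]
      exact fun i => h _ (Fin.succ_ne_zero i)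
    | succ j =>
      rw [h 0 (Fin.succ_ne_zero j).symm, List.nil_append]
      exact ih _ j fun i hi => h _ (Fin.succ_injective _ |>.ne hi)

theorem List.ofFn_getElem_eq_map_of_length_eq {α β : Type*} {T : ℕ} (W : List α) (h : W.length = T) (g : α → β) :
    (List.ofFn fun t : Fin T => g (W[t.val]'(by omega))) = W.map g := by
  subst h
  apply List.ext_getElem <;> simp

theorem card_filter_val_lt {n m : ℕ} (h : m ≤ n) :
    (Finset.univ.filter fun p : Fin n => p.val < m).card = m := by
  simp [Fin.card_filter_val_lt, h]

/-- There is an order on the times in which prescribed steps go up and the others go down. -/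
theorem exists_perm_steps (T : ℕ) (s : ℕ → Bool) : ∃ f : Perm (Fin T),
    ∀ t u : Fin T, u.val = t.val + 1 → if s t then f t < f u else f u < f t := by
  -- The signed value `±t` puts the time `t` above or below all earlier times, as the step leading
  -- to it prescribes; `f` is the rank in this order.
  obtain ⟨g, hg⟩ : ∃ g : Fin T → ℤ, ∀ t, (g t).natAbs = t.val ∧
      (0 < t.val → (0 < g t ↔ s (t.val - 1))) := by
    refine ⟨fun t => if s (t.val - 1) then t.val else -t.val, fun t => ?_⟩
    dsimp only
    split_ifs with h <;> simp [h]
  have key : ∀ a b, g a < g b → (Tuple.sort g)⁻¹ a < (Tuple.sort g)⁻¹ b := fun a b h => by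
    by_contra! hle
    have := Tuple.monotone_sort g hle
    simp at this
    omega
  refine ⟨(Tuple.sort g)⁻¹, fun t u h => ?_⟩
  have h1 := hg t
  have h2 := hg u
  rw [h, Nat.add_sub_cancel] at h2
  split_ifs with hs
  · apply key
    simp only [hs, iff_true] at h2
    omega
  · apply key
    simp only [hs] at h2
    have := h2.2 (by omega)
    simp only [iff_false, not_lt, Bool.false_eq_true] at this
    omega

namespace WordGrid

variable {n T : ℕ}

/-- The row indexed by a time and a position. -/
def row : Fin T × Fin n ≃ Fin (T * n) := finProdFinEquiv

/-- The column indexed by a position and a time. -/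
def col (f : Perm (Fin T)) : Fin n × Fin T ≃ Fin (T * n) :=
  ((Equiv.refl _).prodCongr f).trans (finProdFinEquiv.trans (finCongr (mul_comm n T)))

theorem row_val (t : Fin T) (p : Fin n) : (row (t, p)).val = p.val + n * t.val := rfl

theorem row_lt_iff {s t : Fin T} {p q : Fin n} :
    row (s, p) < row (t, q) ↔ s < t ∨ (s = t ∧ p < q) := by
  rw [Fin.lt_def, row_val, row_val, add_mul_lt_iff p.isLt q.isLt, Fin.lt_def, Fin.lt_def,
    Fin.ext_iff]

theorem col_lt_iff {f : Perm (Fin T)} {s t : Fin T} {p q : Fin n} :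
    col f (p, s) < col f (q, t) ↔ p < q ∨ (p = q ∧ f s < f t) := by
  have e : ∀ (p : Fin n) s, (col f (p, s)).val = (f s).val + T * p.val := fun p s => rfl
  rw [Fin.lt_def, e, e, add_mul_lt_iff (f s).isLt (f t).isLt, Fin.lt_def, Fin.lt_def, Fin.ext_iff]

variable [NeZero T]

/-- The column in which a row has its `X`. -/
def target (π : Fin T → Perm (Fin n)) : Fin T × Fin n ≃ Fin n × Fin T where
  toFun r := (π r.1 r.2, r.1 + 1)
  invFun c := (c.2 - 1, (π (c.2 - 1)).symm c.1)
  left_inv r := by simp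
  right_inv c := by simp

theorem sub_one_val (t : Fin T) :
    (t - 1).val = if t.val = 0 then T - 1 else t.val - 1 := by
  obtain _ | T := T
  · exact t.elim0
  · rw [Fin.coe_sub_one]
    simp only [Fin.ext_iff, Fin.val_zero, Nat.add_sub_cancel]

theorem ne_sub_one (hT : 2 ≤ T) (t : Fin T) : t ≠ t - 1 := fun h => by
  have := congrArg Fin.val h
  rw [sub_one_val] at this
  split_ifs at this <;> omega

/-- The grid diagram in which row `(t, p)` has its `O` in column `(p, t)` and its `X` in column
`(π t p, t + 1)`. -/
def grid (hT : 2 ≤ T) (f : Perm (Fin T)) (π : Fin T → Perm (Fin n)) : GridDiagram (T * n) where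
  O := (col f).symm.trans ((Equiv.prodComm _ _).trans row)
  X := (col f).symm.trans ((target π).symm.trans row)
  disjoint c := by
    obtain ⟨⟨p, t⟩, rfl⟩ := (col f).surjective c
    simp only [trans_apply, symm_apply_apply, prodComm_apply, Prod.swap, ne_eq,
      EmbeddingLike.apply_eq_iff_eq]
    exact fun h => ne_sub_one hT t (congrArg Prod.fst h)

variable {hT : 2 ≤ T} {f : Perm (Fin T)} {π : Fin T → Perm (Fin n)}

theorem O_col (p : Fin n) (t : Fin T) : (grid hT f π).O (col f (p, t)) = row (t, p) := by
  simp [grid]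

theorem X_col (p : Fin n) (t : Fin T) :
    (grid hT f π).X (col f (p, t)) = row (t - 1, (π (t - 1)).symm p) := by
  simp [grid, target]

theorem O_symm_row (t : Fin T) (p : Fin n) : (grid hT f π).O.symm (row (t, p)) = col f (p, t) := by
  rw [symm_apply_eq, O_col]

theorem X_symm_row (t : Fin T) (p : Fin n) :
    (grid hT f π).X.symm (row (t, p)) = col f (π t p, t + 1) := by
  rw [symm_apply_eq, X_col]; simp

/-- The `X` of a column is in the block of rows before that of its `O`, except at time `0`, where
this block is the last one. -/
theorem O_lt_X_iff (p : Fin n) (t : Fin T) :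
    (grid hT f π).O (col f (p, t)) < (grid hT f π).X (col f (p, t)) ↔ t = 0 := by
  rw [O_col, X_col, row_lt_iff, Fin.lt_def, Fin.ext_iff, Fin.ext_iff, sub_one_val, Fin.val_zero]
  split_ifs <;> omega

theorem strands_grid : (grid hT f π).strands = n := by
  have : (Finset.univ.filter fun c => (grid hT f π).O c < (grid hT f π).X c) =
      Finset.univ.image fun p => col f (p, 0) := by
    ext c
    obtain ⟨⟨p, t⟩, rfl⟩ := (col f).surjective c
    simp only [Finset.mem_filter, Finset.mem_univ, true_and, O_lt_X_iff, Finset.mem_image,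
      EmbeddingLike.apply_eq_iff_eq, Prod.mk.injEq, exists_eq_left]
    exact eq_comm
  rw [GridDiagram.strands, this, Finset.card_image_of_injective _ fun p q h => by simpa using h]
  simp

/-- The column of a strand just below row `(t, j)`; the strand was at position `p` at time `t`. -/
def strandCol (f : Perm (Fin T)) (π : Fin T → Perm (Fin n)) (t : Fin T) (j p : Fin n) :
    Fin (T * n) :=
  if p < j then col f (π t p, t + 1) else col f (p, t)

theorem strandCol_injective (hT : 2 ≤ T) (t : Fin T) (j : Fin n) :
    Function.Injective (strandCol f π t j) := by
  have h : t ≠ t + 1 := fun h => ne_sub_one hT (t + 1) (by simpa using h.symm)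
  intro p q hpq
  simp only [strandCol] at hpq
  split_ifs at hpq <;> simp_all

theorem activeCols_grid (t : Fin T) (j : Fin n) :
    (grid hT f π).activeCols (row (t, j)) = Finset.univ.image (strandCol f π t j) := by
  ext c
  obtain ⟨⟨p, s⟩, rfl⟩ := (col f).surjective c
  have hR : col f (p, s) ∈ Finset.univ.image (strandCol f π t j) ↔
      (s = t ∧ j ≤ p) ∨ (s - 1 = t ∧ (π t).symm p < j) := by
    simp only [Finset.mem_image, Finset.mem_univ, true_and, strandCol]
    constructor
    · rintro ⟨q, hq⟩
      split_ifs at hq with h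
      · right
        simp only [EmbeddingLike.apply_eq_iff_eq, Prod.mk.injEq] at hq
        rw [← hq.1, ← hq.2]
        simpa using h
      · left
        simp only [EmbeddingLike.apply_eq_iff_eq, Prod.mk.injEq] at hq
        rw [← hq.1, ← hq.2]
        simpa using h
    · rintro (⟨rfl, h⟩ | ⟨rfl, h⟩)
      · exact ⟨p, by rw [if_neg (not_lt.mpr h)]⟩
      · exact ⟨_, by rw [if_pos h]; simp⟩
  rw [hR]
  simp only [GridDiagram.activeCols, Finset.mem_filter, Finset.mem_univ, true_and, O_lt_X_iff]
  rw [O_col, X_col, ← not_lt, row_lt_iff, row_lt_iff]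
  have hs := sub_one_val s
  by_cases h : s - 1 = t
  · subst h
    simp only [Fin.lt_def, Fin.ext_iff, Fin.le_def, Fin.val_zero, true_and] at *
    split_ifs at hs <;> omega
  · simp only [h, false_and, or_false]
    simp only [Fin.lt_def, Fin.ext_iff, Fin.le_def, Fin.val_zero] at *
    split_ifs at hs <;> omega

theorem strandCol_self (t : Fin T) (j : Fin n) : strandCol f π t j j = col f (j, t) := by
  simp [strandCol]

/-- Labelling the strands by their positions at time `t` turns counts of columns into counts of
positions. The positions below `j` have already moved to the columns of time `t + 1`. -/
theorem rowWord_grid (t : Fin T) (j : Fin n) {p q : ℕ}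
    (hp : (Finset.univ.filter fun p => p < j ∧
      (π t p < j ∨ (π t p = j ∧ f (t + 1) < f t))).card = p)
    (hq : (Finset.univ.filter fun p => (p < j ∧ π t p < π t j) ∨
      (j < p ∧ (p < π t j ∨ (p = π t j ∧ f t < f (t + 1))))).card = q) :
    (grid hT f π).rowWord (row (t, j)) =
      if p ≤ q then (List.range' p (q - p)).map fun j => (j, true)
      else (List.range' q (p - q)).reverse.map fun j => (j, false) := by
  have hp' : (((grid hT f π).activeCols (row (t, j))).filter
      (· < (grid hT f π).O.symm (row (t, j)))).card = p := by
    rw [activeCols_grid, O_symm_row, Finset.filter_image,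
      Finset.card_image_of_injective _ (strandCol_injective hT t j), ← hp]
    congr 1
    ext p
    rw [Finset.mem_filter, Finset.mem_filter]
    simp only [Finset.mem_univ, true_and, strandCol]
    split_ifs with h <;> simp [col_lt_iff, h]
  have hq' : ((((grid hT f π).activeCols (row (t, j))).erase
      ((grid hT f π).O.symm (row (t, j)))).filter
      (· < (grid hT f π).X.symm (row (t, j)))).card = q := by
    rw [activeCols_grid, O_symm_row, X_symm_row, ← strandCol_self (f := f) (π := π) t j,
      ← Finset.image_erase (strandCol_injective hT t j), Finset.filter_image,
      Finset.card_image_of_injective _ (strandCol_injective hT t j), ← hq]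
    congr 1
    ext p
    rw [Finset.mem_filter, Finset.mem_filter]
    simp only [Finset.mem_erase, Finset.mem_univ, true_and, and_true, strandCol]
    rcases lt_trichotomy p j with h | rfl | h
    · simp [h, h.ne, col_lt_iff, not_lt_of_gt h]
    · simp
    · simp [h, h.ne', col_lt_iff, not_lt_of_gt h]
  rw [GridDiagram.rowWord, hp', hq']

end WordGrid

/-! ### The braid word of a word grid -/

namespace WordGrid

variable {n T : ℕ}

/-- The position to the left of a crossing. -/
def leftPos (i : Fin (n - 1)) : Fin n := ⟨i.val, by omega⟩

/-- The position to the right of a crossing. -/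
def rightPos (i : Fin (n - 1)) : Fin n := ⟨i.val + 1, by omega⟩

/-- The permutation of the strands at a letter of a braid word, or at an empty step. -/
def step : Option (Fin (n - 1) × Bool) → Perm (Fin n)
  | none => 1
  | some l => swap (leftPos l.1) (rightPos l.1)

/-- The word of a step. -/
def stepWord : Option (Fin (n - 1) × Bool) → List (ℕ × Bool)
  | none => []
  | some l => [(l.1.val, l.2)]

theorem card_filter_eq {n m : ℕ} {P : Fin n → Prop} [DecidablePred P] (h : m ≤ n)
    (hP : ∀ p, P p ↔ p.val < m) : (Finset.univ.filter P).card = m := by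
  rw [← card_filter_val_lt h]
  congr 1
  ext p
  simp [hP]

theorem card_filter_eq_succ {n m : ℕ} {P : Fin n → Prop} [DecidablePred P] (h : m + 1 < n)
    (hP : ∀ p, P p ↔ p.val < m ∨ p.val = m + 1) : (Finset.univ.filter P).card = m + 1 := by
  have e : Finset.univ.filter P =
      (Finset.univ.filter fun p : Fin n => p.val < m + 2).erase ⟨m, by omega⟩ := by
    ext p
    simp only [Finset.mem_filter, Finset.mem_univ, true_and, hP, Finset.mem_erase, ne_eq,
      Fin.ext_iff]
    omega
  rw [e, Finset.card_erase_of_mem (by simp), card_filter_val_lt (by omega)]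
  rfl

variable [NeZero T] {hT : 2 ≤ T} {f : Perm (Fin T)} {π : Fin T → Perm (Fin n)} {t : Fin T}

theorem rowWord_of_eq_one (h : π t = 1) (j : Fin n) :
    (grid hT f π).rowWord (row (t, j)) = [] := by
  rw [rowWord_grid t j (p := j) (q := j)]
  · simp
  · refine card_filter_eq j.isLt.le fun p => ?_
    simp only [h, Perm.one_apply, Fin.lt_def]
    omega
  · refine card_filter_eq j.isLt.le fun p => ?_
    simp only [h, Perm.one_apply, Fin.lt_def, Fin.ext_iff]
    omega

theorem swap_pos_val (i : Fin (n - 1)) (p : Fin n) : (swap (leftPos i) (rightPos i) p).val =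
    if p.val = i then i.val + 1 else if p.val = i + 1 then i.val else p.val := by
  simp only [swap_apply_def, leftPos, rightPos, Fin.ext_iff]
  split_ifs <;> rfl

/-- Within a column block, time `t + 1` is to the right of time `t`. So the left strand, which moves
first, passes over the right one, and the right strand then moves left without meeting it. -/
theorem rowWord_of_eq_swap {i : Fin (n - 1)} (h : π t = swap (leftPos i) (rightPos i))
    (hf : f t < f (t + 1)) (j : Fin n) :
    (grid hT f π).rowWord (row (t, j)) = if j = leftPos i then [(i.val, true)] else [] := by
  have hi := i.isLt
  have hf' := hf.not_gt
  have hv := swap_pos_val i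
  have hvj := hv j
  have hj : j = leftPos i ↔ j.val = i.val := Fin.ext_iff
  have hjn := j.isLt
  by_cases h1 : j.val = i.val
  · rw [if_pos (hj.mpr h1), rowWord_grid t j (p := i) (q := i + 1)]
    · simp
    · refine card_filter_eq (by omega) fun p => ?_
      have := hv p
      simp only [h, hf', and_false, or_false, Fin.lt_def, Fin.ext_iff]
      split_ifs at this <;> omega
    -- The strand at `i + 1` is left of the target, and the moving strand at `i` is not counted.
    · refine card_filter_eq_succ (by omega) fun p => ?_
      have := hv p
      simp only [h, hf, and_true, Fin.lt_def, Fin.ext_iff]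
      split_ifs at this hvj <;> omega
  · rw [if_neg (mt hj.mp h1)]
    -- At `j = i + 1` only `i` strands are to the left, because the strand from `i` has already
    -- passed to the right.
    obtain ⟨m, hm, hmj⟩ : ∃ m, m ≤ n ∧ m = if j.val = i + 1 then i.val else j.val :=
      ⟨_, by split_ifs <;> omega, rfl⟩
    rw [rowWord_grid t j (p := m) (q := m)]
    · simp
    · refine card_filter_eq hm fun p => ?_
      have := hv p
      simp only [h, hf', and_false, or_false, Fin.lt_def, Fin.ext_iff]
      split_ifs at this hmj <;> omega
    · refine card_filter_eq hm fun p => ?_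
      have := hv p
      simp only [h, hf, and_true, Fin.lt_def, Fin.ext_iff]
      split_ifs at this hvj hmj <;> omega

/-- Now time `t + 1` is to the left of time `t`. The left strand stops short of the right one, which
then passes over it to the left. -/
theorem rowWord_of_eq_swap' {i : Fin (n - 1)} (h : π t = swap (leftPos i) (rightPos i))
    (hf : f (t + 1) < f t) (j : Fin n) :
    (grid hT f π).rowWord (row (t, j)) = if j = rightPos i then [(i.val, false)] else [] := by
  have hi := i.isLt
  have hf' := hf.not_gt
  have hv := swap_pos_val i
  have hvj := hv j
  have hj : j = rightPos i ↔ j.val = i.val + 1 := Fin.ext_iff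
  have hjn := j.isLt
  by_cases h1 : j.val = i.val + 1
  · rw [if_pos (hj.mpr h1), rowWord_grid t j (p := i + 1) (q := i)]
    · simp
    · refine card_filter_eq (by omega) fun p => ?_
      have := hv p
      simp only [h, hf, and_true, Fin.lt_def, Fin.ext_iff]
      split_ifs at this <;> omega
    · refine card_filter_eq (by omega) fun p => ?_
      have := hv p
      simp only [h, hf', and_false, or_false, Fin.lt_def, Fin.ext_iff]
      split_ifs at this hvj <;> omega
  · rw [if_neg (mt hj.mp h1), rowWord_grid t j (p := j) (q := j)]
    · simp
    · refine card_filter_eq hjn.le fun p => ?_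
      have := hv p
      simp only [h, hf, and_true, Fin.lt_def, Fin.ext_iff]
      split_ifs at this <;> omega
    · refine card_filter_eq hjn.le fun p => ?_
      have := hv p
      simp only [h, hf', and_false, or_false, Fin.lt_def, Fin.ext_iff]
      split_ifs at this hvj <;> omega

/-- The order of the times goes up at a positive letter and down at a negative letter. -/
def Compatible (f : Perm (Fin T)) (t : Fin T) (o : Option (Fin (n - 1) × Bool)) : Prop :=
  ∀ l ∈ o, if l.2 then f t < f (t + 1) else f (t + 1) < f t

theorem flatten_rowWord_grid {o : Option (Fin (n - 1) × Bool)} (h : π t = step o)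
    (hf : Compatible f t o) :
    (List.ofFn fun j => (grid hT f π).rowWord (row (t, j))).flatten = stepWord o := by
  match o, h, hf with
  | none, h, _ =>
    simp [rowWord_of_eq_one (by rwa [step] at h), stepWord]
  | some (i, true), h, hf =>
    have hf : f t < f (t + 1) := by simpa using hf _ rfl
    have e := rowWord_of_eq_swap (hT := hT) (f := f) (by rwa [step] at h) hf
    rw [List.flatten_ofFn_of_eq_nil _ (leftPos i) fun j hj => by rw [e, if_neg hj], e, if_pos rfl]
    rfl
  | some (i, false), h, hf =>
    have hf : f (t + 1) < f t := by simpa using hf _ rfl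
    have e := rowWord_of_eq_swap' (hT := hT) (f := f) (by rwa [step] at h) hf
    rw [List.flatten_ofFn_of_eq_nil _ (rightPos i) fun j hj => by rw [e, if_neg hj], e, if_pos rfl]
    rfl

/-- The grid diagram that performs the steps `W`. -/
def ofSteps (hT : 2 ≤ T) (f : Perm (Fin T)) (W : List (Option (Fin (n - 1) × Bool)))
    (hW : W.length = T) : GridDiagram (T * n) :=
  grid hT f fun t => step (W[t.val]'(by omega))

theorem braidWord_ofSteps {W : List (Option (Fin (n - 1) × Bool))} (hW : W.length = T)
    (hf : ∀ t : Fin T, Compatible f t (W[t.val]'(by omega))) :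
    (ofSteps hT f W hW).braidWord = (W.map stepWord).flatten := by
  have e : ∀ (t : Fin T) (j : Fin n) (h : t.val * n + j.val < T * n),
      (⟨t.val * n + j.val, h⟩ : Fin (T * n)) = row (t, j) := fun t j h =>
    Fin.ext (by rw [row_val]; ring)
  rw [GridDiagram.braidWord, List.ofFn_mul, List.flatten_flatten, List.map_ofFn]
  simp only [e]
  rw [← List.ofFn_getElem_eq_map_of_length_eq W hW]
  congr 2
  funext t
  exact flatten_rowWord_grid rfl (hf t)

theorem represents_ofSteps {W : List (Option (Fin (n - 1) × Bool))} (hW : W.length = T)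
    (hf : ∀ t : Fin T, Compatible f t (W[t.val]'(by omega))) :
    (ofSteps hT f W hW).Represents (BraidGroup.ofWord W.reduceOption) := by
  refine ⟨strands_grid, _, ?_, rfl⟩
  rw [braidWord_ofSteps hW hf]
  clear hf hW
  induction W with
  | nil => rfl
  | cons o W ih => cases o <;> simp [stepWord, ← ih]

end WordGrid

/-! ### The two diagrams of the theorem -/

theorem BraidGroup.ofWord_append {n : ℕ} (u v : List (Fin (n - 1) × Bool)) :
    BraidGroup.ofWord (u ++ v) = BraidGroup.ofWord u * BraidGroup.ofWord v := by
  rw [ofWord, ofWord, ofWord, ← map_mul, FreeGroup.mul_mk]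

theorem BraidGroup.exists_ofWord_eq {n : ℕ} (w : BraidGroup n) :
    ∃ v, BraidGroup.ofWord v = w := by
  obtain ⟨x, rfl⟩ := PresentedGroup.mk_surjective _ w
  exact ⟨x.toWord, by rw [ofWord, FreeGroup.mk_toWord]⟩

namespace WordGrid

theorem row_add_one {n T : ℕ} [NeZero (T * n)] (t : Fin T) {p q : Fin n} (h : q.val = p.val + 1) :
    row (t, p) + 1 = row (t, q) := by
  have e := row_val t q
  have e' := row_val t p
  have hlt := (row (t, q)).isLt
  refine Fin.ext ?_
  rw [Fin.val_add_one_eq_ite, if_neg] <;> omega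

variable {n T : ℕ} [NeZero T] {hT : 2 ≤ T} {f : Perm (Fin T)}

/-- Exchanging two strands at time `t` exchanges the `X`s of the rows that move them. -/
theorem grid_X_eq_swap_mul {π π' : Fin T → Perm (Fin n)} {t : Fin T} {p q : Fin n}
    (ht : π t = swap p q) (ht' : π' t = 1) (h : ∀ s, s ≠ t → π s = π' s) :
    (grid hT f π').X = swap (row (t, p)) (row (t, q)) * (grid hT f π).X := by
  -- The rows determine the columns of their `X`s directly, so the inverse permutations are
  -- compared.
  rw [← inv_inj, mul_inv_rev, swap_inv]
  ext r
  obtain ⟨⟨s, a⟩, rfl⟩ := row.surjective r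
  change ((grid hT f π').X.symm (row (s, a))).val =
    ((grid hT f π).X.symm (swap (row (t, p)) (row (t, q)) (row (s, a)))).val
  congr 1
  rw [X_symm_row]
  by_cases hs : s = t
  · subst hs
    have e : swap (row (s, p)) (row (s, q)) (row (s, a)) = row (s, swap p q a) := by
      simp only [swap_apply_def, EmbeddingLike.apply_eq_iff_eq, Prod.mk.injEq, true_and]
      split_ifs <;> rfl
    rw [e, X_symm_row, ht, ht', swap_apply_self, Perm.one_apply]
  · rw [swap_apply_of_ne_of_ne (by simp [hs]) (by simp [hs]), X_symm_row, h s hs]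

end WordGrid

theorem notMem_cyc_add_one_of_between {k : ℕ} [NeZero k] {a b c : Fin k} (h1 : b < c)
    (h2 : c < a) : c ∉ cyc (a + 1) (b + 1) := by
  have ha := Fin.val_add_one_eq_ite a
  have hb := Fin.val_add_one_eq_ite b
  rw [Fin.lt_def] at h1 h2
  have := a.isLt
  rw [mem_cyc]
  split_ifs at ha hb <;> omega

theorem theorem1p1 (n : ℕ) (w : BraidGroup n) (i : Fin (n - 1)) :
    ∃ (k : ℕ) (_ : NeZero k) (D : CombinedDiagram k),
      D.Gβ.Represents (w * BraidGroup.σ i) ∧ D.Gγ.Represents w ∧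
      ∃ h : D.phi ∘ₗ D.Gβ.bd = D.Gγ.bd ∘ₗ D.phi,
        GridDiagram.homologyMap D.phi h D.Gβ.theta = D.Gγ.theta := by
  obtain ⟨v, rfl⟩ := BraidGroup.exists_ofWord_eq w
  -- One time is for the letter `σ i` or its replacement, the other for a final empty step. The
  -- latter ensures `2 ≤ T` and frees the order `f` of any condition on the passage from the last
  -- time back to time `0`.
  obtain ⟨T, hTv⟩ : ∃ T, T = v.length + 2 := ⟨_, rfl⟩
  have hT : 2 ≤ T := by omega
  have : NeZero T := ⟨by omega⟩
  have : NeZero n := ⟨by have := i.isLt; omega⟩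
  have hk : NeZero (T * n) := ⟨mul_ne_zero (NeZero.ne T) (NeZero.ne n)⟩
  obtain ⟨Wβ, hWβ⟩ : ∃ W : List (Option (Fin (n - 1) × Bool)),
    W = v.map some ++ [some (i, true), none] := ⟨_, rfl⟩
  obtain ⟨Wγ, hWγ⟩ : ∃ W : List (Option (Fin (n - 1) × Bool)),
    W = v.map some ++ [none, none] := ⟨_, rfl⟩
  have hlβ : Wβ.length = T := by simp [hWβ, hTv]
  have hlγ : Wγ.length = T := by simp [hWγ, hTv]
  -- One order serves both words, since the second has no letters other than those of the first.
  obtain ⟨f, hf⟩ := exists_perm_steps T fun t => match Wβ[t]? with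
    | some (some l) => l.2
    | _ => true
  obtain ⟨t, ht⟩ : ∃ t : Fin T, t.val = v.length := ⟨⟨v.length, by omega⟩, rfl⟩
  have hne : ∀ s : Fin T, s ≠ t → Wβ[s.val]'(by omega) = Wγ[s.val]'(by omega) := by
    intro s hs
    rw [Ne, Fin.ext_iff, ht] at hs
    rcases (by omega : s.val < v.length ∨ s.val = v.length + 1) with h | h
    · simp [hWβ, hWγ, h]
    · simp [hWβ, hWγ, h]
  have htβ : Wβ[t.val]'(by omega) = some (i, true) := by simp [hWβ, ht]
  have htγ : Wγ[t.val]'(by omega) = none := by simp [hWγ, ht]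
  have hcβ : ∀ t : Fin T, WordGrid.Compatible f t (Wβ[t.val]'(by omega)) := by
    intro s l hl
    have hsT : s.val + 1 < T := by
      by_contra hsT
      have h : s.val = v.length + 1 := by omega
      simp [hWβ, h] at hl
    have hu : (s + 1).val = s.val + 1 := by
      rw [Fin.val_add_one_eq_ite, if_neg hsT.ne]
    have := hf s (s + 1) hu
    rw [List.getElem?_eq_getElem (by omega), Option.mem_def.mp hl] at this
    exact this
  have hcγ : ∀ t : Fin T, WordGrid.Compatible f t (Wγ[t.val]'(by omega)) := by
    intro s
    by_cases hs : s = t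
    · subst hs
      rw [htγ]
      intro l hl
      cases hl
    · rw [← hne s hs]
      exact hcβ s
  have hlt : f t < f (t + 1) := by
    have := hcβ t
    rw [htβ] at this
    simpa using this _ rfl
  have hrow : WordGrid.row (t, WordGrid.leftPos i) + 1 = WordGrid.row (t, WordGrid.rightPos i) :=
    WordGrid.row_add_one t rfl
  let D : CombinedDiagram (T * n) :=
    { Gβ := WordGrid.ofSteps hT f Wβ hlβ
      Gγ := WordGrid.ofSteps hT f Wγ hlγ
      row := WordGrid.row (t, WordGrid.leftPos i)
      -- The crossing is placed as far right as allowed, in the column of the upper `X`.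
      cross := (WordGrid.ofSteps hT f Wβ hlβ).X.symm (WordGrid.row (t, WordGrid.leftPos i) + 1)
      O_eq := rfl
      X_eq := by
        rw [hrow]
        refine WordGrid.grid_X_eq_swap_mul ?_ ?_ fun s hs => ?_
        · rw [htβ]; rfl
        · rw [htγ]; rfl
        · rw [hne s hs]
      cross_mem := le_rfl }
  have hO : D.Gβ.O.symm (D.row + 1) ∉ cyc (D.lowerCol + 1) (D.upperCol + 1) := by
    have e1 : D.Gβ.O.symm (D.row + 1) = WordGrid.col f (WordGrid.rightPos i, t) := by
      change D.Gβ.O.symm (WordGrid.row (t, WordGrid.leftPos i) + 1) = _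
      rw [hrow]
      exact WordGrid.O_symm_row (hT := hT) _ _
    have e2 : D.lowerCol = WordGrid.col f (WordGrid.rightPos i, t + 1) := by
      refine (WordGrid.X_symm_row (hT := hT) _ _).trans ?_
      rw [htβ]
      simp [WordGrid.step]
    have e3 : D.upperCol = WordGrid.col f (WordGrid.leftPos i, t + 1) := by
      change D.Gβ.X.symm (WordGrid.row (t, WordGrid.leftPos i) + 1) = _
      rw [hrow]
      refine (WordGrid.X_symm_row (hT := hT) _ _).trans ?_
      rw [htβ]
      simp [WordGrid.step]
    rw [e1, e2, e3]
    -- Positivity of the letter enters here: from left to right come the upper `X`, the `O` in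
    -- question and the lower `X`; the last two are in one column block, ordered by `f t < f (t +
    -- 1)`.
    apply notMem_cyc_add_one_of_between
    · exact WordGrid.col_lt_iff.mpr (Or.inl (Nat.lt_succ_self _))
    · exact WordGrid.col_lt_iff.mpr (Or.inr ⟨rfl, hlt⟩)
  refine ⟨T * n, hk, D, ?_, ?_, D.phi_comp_bd, D.homologyMap_theta rfl hO⟩
  · have e : BraidGroup.ofWord v * BraidGroup.σ i = BraidGroup.ofWord Wβ.reduceOption := by
      have : Wβ.reduceOption = v ++ [(i, true)] := by
        simp [hWβ, List.reduceOption]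
      rw [this, BraidGroup.ofWord_append]
      rfl
    rw [e]
    exact WordGrid.represents_ofSteps (hT := hT) hlβ hcβ
  · have e : Wγ.reduceOption = v := by simp [hWγ, List.reduceOption]
    rw [← e]
    exact WordGrid.represents_ofSteps (hT := hT) hlγ hcγ
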